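/- **Setting.** Let $x=(x^1,x^2,x^3,x^4)$ be the coordinates of $\mathbb R^4$; commas denote partial derivatives, Latin indices run over $1,\dots,4$, Greek indices over $\{3,4\}$, and repeated indices are summed. Let $\mathcal G$ be a finite-dimensional real Lie algebra with a symmetric nondegenerate scalar product "." such that $f.[k,l]=[f,k].l$, and let $V\in C^\infty(\mathbb R)$. Let $L\subset\mathbb R^4$, and let $G=G^1_{T_1}=\{x\in L: x^1=0,\ 0\le x^1+x^2\le T_1\}$ be contained in the closure of its interior relative to the hyperplane $\{x^1=0\}$. On an open neighbourhood of $G$ let $g_{ij}$ (symmetric and nondegenerate, for instance Lorentzian), $A_i$ ($\mathcal G$-valued) and $\Phi$ ($\mathcal G$-valued) be $C^\infty$. Put $$\Gamma^k_{ij}=\tfrac12 g^{km}(g_{mj,i}+g_{mi,j}-g_{ij,m}),\quad \Gamma^k=g^{ij}\Gamma^k_{ij},\quad R_{ij}=\Gamma^k_{ij,k}-\Gamma^k_{ik,j}+\Gamma^k_{kl}\Gamma^l_{ij}-\Gamma^k_{jl}\Gamma^l_{ik},$$ $$F_{ij}=A_{j,i}-A_{i,j}+[A_i,A_j],\quad \widehat\nabla_iF^{ij}=\nabla_iF^{ij}+[A_i,F^{ij}],\quad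 \widehat\nabla_i\Phi=\Phi_{,i}+[A_i,\Phi],\quad J^k=[\Phi,\widehat\nabla^k\Phi],$$ $$\Delta=\nabla_iA^i=g^{ik}(A_{k,i}-\Gamma^l_{ik}A_l),\qquad LA_p=g_{jp}\widehat\nabla_iF^{ij}+\Delta_{,p}+\Gamma^l_{,p}A_l+\Gamma^lA_{l,p},$$ $$\tau_{ij}=F_{ik}.F_j{}^k-\tfrac14g_{ij}F_{kl}.F^{kl}+\widehat\nabla_i\Phi.\widehat\nabla_j\Phi+\tfrac12g_{ij}V(\Phi.\Phi).$$ Assume that on $G$: $g_{22}=g_{23}=g_{24}=0$ and $A_2=0$; $g_{\alpha\beta}=\Omega h_{\alpha\beta}$ with $\det(h_{\alpha\beta})=1$ and a function $\Omega>0$ that is $C^\infty$ near $G$ in $\{x^1=0\}$; $g_{12,2}=\frac12g_{12}\Omega_{,2}/\Omega$; and $g_{22,1}=2g_{12,2}$. (On $G$ one has $g^{12}=1/g_{12}$, and $(g^{\alpha\beta})$ is the inverse of the $2\times2$ matrix $(g_{\alpha\beta})$.) A quantity is called *known* if it is built from the restrictions of $g_{12},g_{\alpha\beta},A_\alpha,\Phi$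 to $\{x^1=0\}$ and their derivatives in $x^2,x^3,x^4$ only; $g_{22,1}=2g_{12,2}$ is known. **Proposition 3.7.** (i) On $G$, for $\alpha\in\{3,4\}$, $$R_{2\alpha}+\tfrac12g_{\alpha\beta}\Gamma^\beta_{,2}+\bigl(g^{12}g_{12,2}g_{\alpha\beta}+\tfrac12g_{\alpha\beta,2}\bigr)\Gamma^\beta = g^{12}g_{1\alpha,22}+(g^{12})^2g_{12,2}g_{1\alpha,2}-g_{\alpha\beta,2}g^{\beta\lambda}g^{12}g_{1\lambda,2}+\chi^{\lambda}_{0\alpha}g_{1\lambda}+c_\alpha,$$ $$LA_2-2\Delta_{,2}-2g^{12}g_{12,2}\Delta-2(g^{12}g_{12,2}A_\nu+A_{\nu,2})\Gamma^\nu-2A_\nu\Gamma^\nu_{,2} = -2g^{12}A_{1,22}-2(g^{12})^2g_{12,2}A_{1,2}+2g^{12}g^{\alpha\lambda}A_{\alpha,2}g_{1\lambda,2}+K^\lambda g_{1\lambda}+A_g,$$ with the known quantities $$\chi^\lambda_{0\alpha}=(g^{12})^2g_{12,2}g_{\alpha\beta}g^{\beta\lambda}_{,2}+\tfrac12\bigl[g_{\alpha\beta}g^{12}g^{\beta\lambda}_{,22}-g^{12}g^{\beta\lambda}g_{\alpha\beta,22}\bigr],$$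 $$\begin{aligned}c_\alpha={}&\tfrac12g^{12}g_{12,2}\bigl[-2g^{12}g_{12,\alpha}+g^{\mu\theta}(2g_{\alpha\mu,\theta}-g_{\mu\theta,\alpha})\bigr]+\tfrac14g_{\alpha\beta,2}B^\beta+\tfrac12(g^{\lambda\beta}g_{\alpha\beta,2})_{,\lambda}-3(g^{12}g_{12,2})_{,\alpha}\\&-\tfrac12(g^{12})^2g_{12,2}g_{12,\alpha}+\tfrac12g^{12}(g_{22,1\alpha}+g_{12,2\alpha})+\tfrac14g^{\beta\lambda}_{,2}g_{\lambda\beta,\alpha}+\tfrac14g_{\alpha\beta,2}g^{\beta\lambda}g^{\mu\theta}g_{\mu\theta,\lambda}+\tfrac14g_{\alpha\beta}B^\beta_{,2},\\B^\beta={}&-2g^{\beta\lambda}g^{12}g_{12,\lambda}+g^{\beta\lambda}g^{\mu\theta}(2g_{\lambda\mu,\theta}-g_{\mu\theta,\lambda}),\end{aligned}$$ $$\begin{aligned}K^\lambda={}&4(g^{12})^2g_{12,2}g^{\alpha\lambda}A_{\alpha,2}+\bigl[2g^{12}g^{\alpha\lambda}g^{\beta\mu}g_{\mu\beta,2}A_\alpha+2g^{12}g^{\alpha\lambda}A_{\alpha,2}\bigr]_{,2}\\&-2(g^{12}g^{\alpha\lambda}A_\alpha)_{,2}\,g^{\beta\mu}g_{\mu\beta,2}-2g^{12}g^{\alpha\lambda}A_\alpha\bigl[g^{\beta\mu}g_{\mu\beta,2}\bigr]_{,2},\end{aligned}$$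 and, with $t_\lambda=g^{\beta\mu}(g_{\mu\lambda,\beta}+g_{\lambda\beta,\mu}-g_{\mu\beta,\lambda})$, $$\begin{aligned}A_g={}&-2(g^{12}g^{\alpha\lambda}A_\alpha)_{,2}g_{12,\lambda}-2g^{12}g^{\alpha\lambda}A_\alpha g_{12,2\lambda}-g^{\beta\alpha}\bigl([A_\beta,A_{\alpha,2}]-g^{12}g_{12,\beta}A_{\alpha,2}\bigr)\\&+(g^{12}g^{\alpha\lambda}A_\alpha)_{,2}\,g_{12}t_\lambda+g^{12}g^{\alpha\lambda}A_\alpha(g_{12}t_\lambda)_{,2}\\&-\bigl\{g^{\alpha\beta}\bigl[g^{12}g_{12,\beta}+\tfrac12g^{\lambda\mu}(g_{\mu\beta,\lambda}+g_{\lambda\mu,\beta}-g_{\beta\lambda,\mu})\bigr]+g^{\alpha\beta}_{,\beta}\bigr\}A_{\alpha,2}\\&+\bigl(2g^{12}g^{\alpha\lambda}g_{12,\lambda}A_\alpha-g^{\alpha\delta}t_\delta A_\alpha\bigr)_{,2}-2g^{\alpha\beta}A_{\alpha,2\beta}-2g^{12}g_{12,2}g^{\alpha\beta}A_{\alpha,\beta}-g^{\alpha\beta}_{,2}A_{\alpha,\beta}.\end{aligned}$$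 (ii) At every point of $G$, the system $$R_{2\alpha}+\tfrac12g_{\alpha\beta}\Gamma^\beta_{,2}+\bigl(g^{12}g_{12,2}g_{\alpha\beta}+\tfrac12g_{\alpha\beta,2}+A_\beta.A_{\alpha,2}\bigr)\Gamma^\beta+A_{\alpha,2}.\Delta=\tau_{2\alpha}\quad(\alpha=3,4),$$ $$LA_2-2\Delta_{,2}-2g^{12}g_{12,2}\Delta-2(g^{12}g_{12,2}A_\nu+A_{\nu,2})\Gamma^\nu-2A_\nu\Gamma^\nu_{,2}=J_2$$ is equivalent to the following linear second-order system of ODEs in $x^2$ for $(A_1,g_{13},g_{14})$, whose coefficients are all known: $$g^{12}g_{1\alpha,22}+\kappa_\alpha^\lambda g_{1\lambda,2}+\varkappa_\alpha.A_{1,2}+\chi_\alpha^\lambda g_{1\lambda}+\digamma_\alpha=0\quad(\alpha=3,4),$$ $$-2g^{12}A_{1,22}-2(g^{12})^2g_{12,2}A_{1,2}+2g^{12}g^{\alpha\lambda}A_{\alpha,2}g_{1\lambda,2}+a^\lambda g_{1\lambda}+b=0,$$ where $$\kappa_\alpha^\lambda=(g^{12})^2g_{12,2}\delta_\alpha^\lambda-g^{12}g_{\alpha\beta,2}g^{\beta\lambda},\quad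 \varkappa_\alpha=2g^{12}A_{\alpha,2},\quad \chi_\alpha^\lambda=\chi_{0\alpha}^\lambda-2g^{\nu\lambda}g^{12}A_{\alpha,2}.A_{\nu,2},\quad a^\lambda=K^\lambda,$$ $$\digamma_\alpha=c_\alpha+g^{\beta\lambda}(A_{\alpha,\lambda}-A_{\lambda,\alpha}+[A_\lambda,A_\alpha]).A_{\beta,2}+g^{\mu\nu}A_{\alpha,2}.A_{\mu,\nu}-\Phi_{,2}.(\Phi_{,\alpha}+[A_\alpha,\Phi]),$$ $$b=A_g-J_2,\qquad J_2=[\Phi,\Phi_{,2}].$$ -/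

import Mathlib

open scoped ContDiff

noncomputable section

namespace EYMH

/-! Coordinates and derivatives. The coordinates `(x¹, x², x³, x⁴)` of `ℝ⁴` carry the indices
`0, 1, 2, 3`, and the coordinates `(x², x³, x⁴)` of the hyperplane `x¹ = 0` carry the indices
`0, 1, 2`. A Greek index `α ∈ {3, 4}` is an element `a : Fin 2`. -/

/-- Coordinate space of dimension `n`. -/
abbrev Sp (n : ℕ) : Type := Fin n → ℝ

/-- The partial derivative of a real function in the `i`-th coordinate. -/
def pd {n : ℕ} (i : Fin n) (f : Sp n → ℝ) : Sp n → ℝ :=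
  fun x => fderiv ℝ f x (Pi.single i 1)

/-- The partial derivative of a function with values in a real vector space with basis `ε`,
taken component by component. -/
def pdL {n N : ℕ} {𝔤 : Type*} [AddCommGroup 𝔤] [Module ℝ 𝔤] (ε : Module.Basis (Fin N) ℝ 𝔤)
    (i : Fin n) (f : Sp n → 𝔤) : Sp n → 𝔤 :=
  fun x => ∑ I, pd i (fun z => ε.repr (f z) I) x • ε I

/-- The Greek index `a`, as an index of the four coordinates: `0 ↦ x³`, `1 ↦ x⁴`. -/
abbrev gk (a : Fin 2) : Fin 4 := a.succ.succ

/-- The Greek index `a`, as an index of the coordinates `(x², x³, x⁴)` of the hyperplane. -/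
abbrev gs (a : Fin 2) : Fin 3 := a.succ

/-- The hyperplane `x¹ = 0`: `(x², x³, x⁴) ↦ (0, x², x³, x⁴)`. -/
def emb (y : Sp 3) : Sp 4 := Fin.cons 0 y

/-- `G¹_T = {x ∈ L : x¹ = 0, 0 ≤ x¹ + x² ≤ T}`. -/
def G1 (L : Set (Sp 4)) (T : ℝ) : Set (Sp 4) :=
  {x | x ∈ L ∧ x 0 = 0 ∧ 0 ≤ x 0 + x 1 ∧ x 0 + x 1 ≤ T}

/-- `G¹_T` in the coordinates `(x², x³, x⁴)` of the hyperplane `x¹ = 0`. -/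
def slice (L : Set (Sp 4)) (T : ℝ) : Set (Sp 3) := {y | emb y ∈ G1 L T}

/-- The components of a metric, of a Yang-Mills potential and of a Higgs field. -/
structure Fields (𝔤 : Type*) where
  g : Fin 4 → Fin 4 → Sp 4 → ℝ
  A : Fin 4 → Sp 4 → 𝔤
  Φ : Sp 4 → 𝔤

/-- The quantities on the hyperplane `x¹ = 0` that are known at the stage under consideration:
`g₁₂`, `g_{αβ}`, `A_α` and `Φ`, as functions of `(x², x³, x⁴)`. -/
structure Known (𝔤 : Type*) where
  g12 : Sp 3 → ℝ
  q : Fin 2 → Fin 2 → Sp 3 → ℝ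
  A : Fin 2 → Sp 3 → 𝔤
  Φ : Sp 3 → 𝔤

section FourDim

namespace Fields

variable {𝔤 : Type*} [LieRing 𝔤] [LieAlgebra ℝ 𝔤] {N : ℕ}

/-- On `U` the components of the fields are `C^∞` and `g` is symmetric and nondegenerate. -/
structure RegularOn (F : Fields 𝔤) (ε : Module.Basis (Fin N) ℝ 𝔤) (U : Set (Sp 4)) : Prop where
  smooth_g : ∀ i j, ContDiffOn ℝ ∞ (F.g i j) U
  smooth_A : ∀ i I, ContDiffOn ℝ ∞ (fun x => ε.repr (F.A i x) I) U
  smooth_Φ : ∀ I, ContDiffOn ℝ ∞ (fun x => ε.repr (F.Φ x) I) U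
  symm : ∀ i j, ∀ x ∈ U, F.g i j x = F.g j i x
  nondeg : ∀ x ∈ U, (Matrix.of fun i j => F.g i j x).det ≠ 0

/-- The inverse metric `g^{ij}`. -/
def gInv (F : Fields 𝔤) (i j : Fin 4) : Sp 4 → ℝ :=
  fun x => (Matrix.of fun k l => F.g k l x)⁻¹ i j

/-- The Christoffel symbols `Γ^k_{ij} = ½ g^{km} (g_{mj,i} + g_{mi,j} - g_{ij,m})`. -/
def chr (F : Fields 𝔤) (k i j : Fin 4) : Sp 4 → ℝ := fun x =>
  (1 / 2) * ∑ m, F.gInv k m x * (pd i (F.g m j) x + pd j (F.g m i) x - pd m (F.g i j) x)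

/-- `Γ^k = g^{ij} Γ^k_{ij}`. -/
def Γ (F : Fields 𝔤) (k : Fin 4) : Sp 4 → ℝ := fun x =>
  ∑ i, ∑ j, F.gInv i j x * F.chr k i j x

/-- The Ricci tensor
`R_{ij} = Γ^k_{ij,k} - Γ^k_{ik,j} + Γ^k_{kl} Γ^l_{ij} - Γ^k_{jl} Γ^l_{ik}`. -/
def ricci (F : Fields 𝔤) (i j : Fin 4) : Sp 4 → ℝ := fun x =>
  ∑ k, (pd k (F.chr k i j) x - pd j (F.chr k i k) x)
    + ∑ k, ∑ l, (F.chr k k l x * F.chr l i j x - F.chr k j l x * F.chr l i k x)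

/-- The Yang-Mills field `F = dA + ½ [A, A]`, that is
`F_{ij} = ∂_i A_j - ∂_j A_i + [A_i, A_j]`. -/
def curv (F : Fields 𝔤) (ε : Module.Basis (Fin N) ℝ 𝔤) (i j : Fin 4) : Sp 4 → 𝔤 := fun x =>
  pdL ε i (F.A j) x - pdL ε j (F.A i) x + ⁅F.A i x, F.A j x⁆

/-- `F^{ij} = g^{ia} g^{jb} F_{ab}`. -/
def curvUp (F : Fields 𝔤) (ε : Module.Basis (Fin N) ℝ 𝔤) (i j : Fin 4) : Sp 4 → 𝔤 := fun x =>
  ∑ a, ∑ b, (F.gInv i a x * F.gInv j b x) • F.curv ε a b x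

/-- The gauge covariant divergence `∇̂_i F^{ij} = ∇_i F^{ij} + [A_i, F^{ij}]`, with
`∇_i F^{ij} = ∂_i F^{ij} + Γ^i_{im} F^{mj} + Γ^j_{im} F^{im}`. -/
def divCurv (F : Fields 𝔤) (ε : Module.Basis (Fin N) ℝ 𝔤) (j : Fin 4) : Sp 4 → 𝔤 := fun x =>
  ∑ i, (pdL ε i (F.curvUp ε i j) x
    + ∑ m, (F.chr i i m x • F.curvUp ε m j x + F.chr j i m x • F.curvUp ε i m x)
    + ⁅F.A i x, F.curvUp ε i j x⁆)

/-- The Lorentz gauge quantity `Δ = ∇_i A^i = g^{ik} (A_{k,i} - Γ^l_{ik} A_l)`. -/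
def Δ (F : Fields 𝔤) (ε : Module.Basis (Fin N) ℝ 𝔤) : Sp 4 → 𝔤 := fun x =>
  ∑ i, ∑ k, F.gInv i k x • (pdL ε i (F.A k) x - ∑ l, F.chr l i k x • F.A l x)

/-- `LA_p = g_{jp} ∇̂_i F^{ij} + (Δ_{,p} + Γ^l_{,p} A_l + Γ^l A_{l,p})`. -/
def LA (F : Fields 𝔤) (ε : Module.Basis (Fin N) ℝ 𝔤) (p : Fin 4) : Sp 4 → 𝔤 := fun x =>
  ∑ j, F.g j p x • F.divCurv ε j x
    + (pdL ε p (F.Δ ε) x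
      + ∑ l, (pd p (F.Γ l) x • F.A l x + F.Γ l x • pdL ε p (F.A l) x))

/-- `∇̂_i Φ = ∂_i Φ + [A_i, Φ]`. -/
def dHiggs (F : Fields 𝔤) (ε : Module.Basis (Fin N) ℝ 𝔤) (i : Fin 4) : Sp 4 → 𝔤 := fun x =>
  pdL ε i F.Φ x + ⁅F.A i x, F.Φ x⁆

/-- The Yang-Mills current `J^k = [Φ, ∇̂^k Φ]`. -/
def currentUp (F : Fields 𝔤) (ε : Module.Basis (Fin N) ℝ 𝔤) (k : Fin 4) : Sp 4 → 𝔤 := fun x =>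
  ⁅F.Φ x, ∑ i, F.gInv k i x • F.dHiggs ε i x⁆

/-- `J_p = g_{pk} J^k`. -/
def J (F : Fields 𝔤) (ε : Module.Basis (Fin N) ℝ 𝔤) (p : Fin 4) : Sp 4 → 𝔤 := fun x =>
  ∑ k, F.g p k x • F.currentUp ε k x

/-- `τ_{ij} = F_{ik}.F_j^k - ¼ g_{ij} F_{kl}.F^{kl} + ∇̂_i Φ.∇̂_j Φ + ½ g_{ij} V(Φ.Φ)`, where
`F_j^k = g^{kl} F_{jl}` and the dot is the scalar product `B`. -/
def τ (F : Fields 𝔤) (ε : Module.Basis (Fin N) ℝ 𝔤) (B : LinearMap.BilinForm ℝ 𝔤) (V : ℝ → ℝ)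
    (i j : Fin 4) : Sp 4 → ℝ := fun x =>
  ∑ k, B (F.curv ε i k x) (∑ l, F.gInv k l x • F.curv ε j l x)
    - (1 / 4) * F.g i j x * ∑ k, ∑ l, B (F.curv ε k l x) (F.curvUp ε k l x)
    + B (F.dHiggs ε i x) (F.dHiggs ε j x)
    + (1 / 2) * F.g i j x * V (B (F.Φ x) (F.Φ x))

/-- The known quantities of the fields on `x¹ = 0`. -/
def known (F : Fields 𝔤) : Known 𝔤 where
  g12 := fun y => F.g 0 1 (emb y)
  q := fun a b y => F.g (gk a) (gk b) (emb y)
  A := fun a y => F.A (gk a) (emb y)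
  Φ := fun y => F.Φ (emb y)

/-- The unknowns `g_{1α}` on `x¹ = 0`. -/
def unkG (F : Fields 𝔤) (a : Fin 2) : Sp 3 → ℝ := fun y => F.g 0 (gk a) (emb y)

/-- The unknown `A₁` on `x¹ = 0`. -/
def unkA (F : Fields 𝔤) : Sp 3 → 𝔤 := fun y => F.A 0 (emb y)

/-- The conditions on `S ⊆ {x¹ = 0}` at the stage under consideration:
`g₂₂ = g₂₃ = g₂₄ = 0` and `A₂ = 0`; `g_{αβ} = Ω h_{αβ}` with `Ω > 0` and `det (h_{αβ}) = 1`;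
`g_{12,2} = ½ g₁₂ Ω_{,2} / Ω`; and `g_{22,1} = 2 g_{12,2}`. -/
structure Stage (F : Fields 𝔤) (S : Set (Sp 3)) (Ω : Sp 3 → ℝ)
    (h : Fin 2 → Fin 2 → Sp 3 → ℝ) : Prop where
  g22 : ∀ y ∈ S, F.g 1 1 (emb y) = 0
  g2a : ∀ a, ∀ y ∈ S, F.g 1 (gk a) (emb y) = 0
  A2 : ∀ y ∈ S, F.A 1 (emb y) = 0
  Ω_pos : ∀ y ∈ S, 0 < Ω y
  det_h : ∀ y ∈ S, (Matrix.of fun a b => h a b y).det = 1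
  conf : ∀ a b, ∀ y ∈ S, F.g (gk a) (gk b) (emb y) = Ω y * h a b y
  g12 : ∀ y ∈ S, pd 1 (F.g 0 1) (emb y) = (1 / 2) * F.g 0 1 (emb y) * (pd 0 Ω y / Ω y)
  g221 : ∀ y ∈ S, pd 0 (F.g 1 1) (emb y) = 2 * pd 1 (F.g 0 1) (emb y)

/-- `R_{2α} + ½ g_{αβ} Γ^β_{,2} + (g^{12} g_{12,2} g_{αβ} + ½ g_{αβ,2}) Γ^β`. -/
def combR (F : Fields 𝔤) (a : Fin 2) : Sp 4 → ℝ := fun x =>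
  F.ricci 1 (gk a) x
    + (1 / 2) * ∑ b, F.g (gk a) (gk b) x * pd 1 (F.Γ (gk b)) x
    + ∑ b, (F.gInv 0 1 x * pd 1 (F.g 0 1) x * F.g (gk a) (gk b) x
        + (1 / 2) * pd 1 (F.g (gk a) (gk b)) x) * F.Γ (gk b) x

/-- `LA₂ - 2 Δ_{,2} - 2 g^{12} g_{12,2} Δ - 2 (g^{12} g_{12,2} A_ν + A_{ν,2}) Γ^ν
- 2 A_ν Γ^ν_{,2}`. -/
def combA (F : Fields 𝔤) (ε : Module.Basis (Fin N) ℝ 𝔤) : Sp 4 → 𝔤 := fun x =>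
  F.LA ε 1 x - (2 : ℝ) • pdL ε 1 (F.Δ ε) x
    - (2 * F.gInv 0 1 x * pd 1 (F.g 0 1) x) • F.Δ ε x
    - (2 : ℝ) • ∑ v, F.Γ (gk v) x • ((F.gInv 0 1 x * pd 1 (F.g 0 1) x) • F.A (gk v) x
        + pdL ε 1 (F.A (gk v)) x)
    - (2 : ℝ) • ∑ v, pd 1 (F.Γ (gk v)) x • F.A (gk v) x

/-- The equations `R_{2α} = τ_{2α}` (`α = 3, 4`) and `LA₂ = J₂`, modified by gauge terms, at the
point `x`:
`R_{2α} + ½ g_{αβ} Γ^β_{,2} + (g^{12} g_{12,2} g_{αβ} + ½ g_{αβ,2} + A_β.A_{α,2}) Γ^β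
+ A_{α,2}.Δ = τ_{2α}` and
`LA₂ - 2 Δ_{,2} - 2 g^{12} g_{12,2} Δ - 2 (g^{12} g_{12,2} A_ν + A_{ν,2}) Γ^ν - 2 A_ν Γ^ν_{,2}
= J₂`. -/
def ModifiedReduced (F : Fields 𝔤) (ε : Module.Basis (Fin N) ℝ 𝔤) (B : LinearMap.BilinForm ℝ 𝔤)
    (V : ℝ → ℝ) (x : Sp 4) : Prop :=
  (∀ a : Fin 2,
    F.combR a x + ∑ b, B (F.A (gk b) x) (pdL ε 1 (F.A (gk a)) x) * F.Γ (gk b) x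
      + B (pdL ε 1 (F.A (gk a)) x) (F.Δ ε x) = F.τ ε B V 1 (gk a) x) ∧
  F.combA ε x = F.J ε 1 x

end Fields

end FourDim

section ThreeDim

namespace Known

variable {𝔤 : Type*} [LieRing 𝔤] [LieAlgebra ℝ 𝔤] {N : ℕ}

/-- `g^{12} = 1 / g₁₂` on `x¹ = 0`. -/
def n (K : Known 𝔤) : Sp 3 → ℝ := fun y => (K.g12 y)⁻¹

/-- `g^{αβ}`: the inverse of the `2 × 2` matrix `(g_{αβ})`. -/
def u (K : Known 𝔤) (a b : Fin 2) : Sp 3 → ℝ := fun y =>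
  (Matrix.of fun c d => K.q c d y)⁻¹ a b

/-- `g_{12,2}`. -/
def g122 (K : Known 𝔤) : Sp 3 → ℝ := pd 0 K.g12

/-- The value `2 g_{12,2}` of `g_{22,1}`. -/
def g221 (K : Known 𝔤) : Sp 3 → ℝ := fun y => 2 * K.g122 y

/-- `g^{μθ} (2 g_{αμ,θ} - g_{μθ,α})`. -/
def s (K : Known 𝔤) (a : Fin 2) : Sp 3 → ℝ := fun y =>
  ∑ m, ∑ t, K.u m t y * (2 * pd (gs t) (K.q a m) y - pd (gs a) (K.q m t) y)

/-- `-2 g^{βλ} g^{12} g_{12,λ} + g^{βλ} g^{μθ} (2 g_{λμ,θ} - g_{μθ,λ})`. -/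
def br (K : Known 𝔤) (b : Fin 2) : Sp 3 → ℝ := fun y =>
  ∑ l, (-2 * K.u b l y * K.n y * pd (gs l) K.g12 y + K.u b l y * K.s l y)

/-- The term `c_α`:
`½ g^{12} g_{12,2} [-2 g^{12} g_{12,α} + g^{μθ} (2 g_{αμ,θ} - g_{μθ,α})]`
`+ ¼ g_{αβ,2} [-2 g^{βλ} g^{12} g_{12,λ} + g^{βλ} g^{μθ} (2 g_{λμ,θ} - g_{μθ,λ})]`
`+ ½ (g^{λβ} g_{αβ,2})_{,λ} - 3 (g^{12} g_{12,2})_{,α} - ½ (g^{12})² g_{12,2} g_{12,α}`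
`+ ½ g^{12} (g_{22,1α} + g_{12,2α}) + ¼ g^{βλ}_{,2} g_{λβ,α}`
`+ ¼ g_{αβ,2} g^{βλ} g^{μθ} g_{μθ,λ}`
`+ ¼ g_{αβ} [-2 g^{βλ} g^{12} g_{12,λ} + g^{βλ} g^{μθ} (2 g_{λμ,θ} - g_{μθ,λ})]_{,2}`. -/
def c (K : Known 𝔤) (a : Fin 2) : Sp 3 → ℝ := fun y =>
  (1 / 2) * K.n y * K.g122 y * (-2 * K.n y * pd (gs a) K.g12 y + K.s a y)
    + (1 / 4) * ∑ b, pd 0 (K.q a b) y * K.br b y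
    + (1 / 2) * ∑ l, ∑ b, pd (gs l) (fun z => K.u l b z * pd 0 (K.q a b) z) y
    - 3 * pd (gs a) (fun z => K.n z * K.g122 z) y
    - (1 / 2) * K.n y ^ 2 * K.g122 y * pd (gs a) K.g12 y
    + (1 / 2) * K.n y * (pd (gs a) K.g221 y + pd (gs a) K.g122 y)
    + (1 / 4) * ∑ b, ∑ l, pd 0 (K.u b l) y * pd (gs a) (K.q l b) y
    + (1 / 4) * ∑ b, ∑ l, ∑ m, ∑ t,
        pd 0 (K.q a b) y * K.u b l y * K.u m t y * pd (gs l) (K.q m t) y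
    + (1 / 4) * ∑ b, K.q a b y * pd 0 (K.br b) y

/-- The coefficient of `g_{1λ}` in the first combination:
`(g^{12})² g_{12,2} g_{αβ} g^{βλ}_{,2}`
`+ ½ [g_{αβ} g^{12} g^{βλ}_{,22} - g^{12} g^{βλ} g_{αβ,22}]`. -/
def χ₀ (K : Known 𝔤) (a l : Fin 2) : Sp 3 → ℝ := fun y =>
  ∑ b, (K.n y ^ 2 * K.g122 y * K.q a b y * pd 0 (K.u b l) y
    + (1 / 2) * (K.q a b y * K.n y * pd 0 (pd 0 (K.u b l)) y
      - K.n y * K.u b l y * pd 0 (pd 0 (K.q a b)) y))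

/-- `g^{βμ} g_{μβ,2}`. -/
def tr2 (K : Known 𝔤) : Sp 3 → ℝ := fun y => ∑ b, ∑ m, K.u b m y * pd 0 (K.q m b) y

/-- `g^{βμ} (g_{μλ,β} + g_{λβ,μ} - g_{μβ,λ})`. -/
def t (K : Known 𝔤) (l : Fin 2) : Sp 3 → ℝ := fun y =>
  ∑ b, ∑ m, K.u b m y *
    (pd (gs b) (K.q m l) y + pd (gs m) (K.q l b) y - pd (gs l) (K.q m b) y)

/-- `g^{12} g^{αλ} A_α`. -/
def w (K : Known 𝔤) (l : Fin 2) : Sp 3 → 𝔤 := fun y => ∑ a, (K.n y * K.u a l y) • K.A a y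

/-- `g^{12} g^{αλ} A_{α,2}`. -/
def w₂ (K : Known 𝔤) (ε : Module.Basis (Fin N) ℝ 𝔤) (l : Fin 2) : Sp 3 → 𝔤 := fun y =>
  ∑ a, (K.n y * K.u a l y) • pdL ε 0 (K.A a) y

/-- The coefficient `K^λ` of `g_{1λ}` in the second combination:
`4 (g^{12})² g_{12,2} g^{αλ} A_{α,2}`
`+ [2 g^{12} g^{αλ} g^{βμ} g_{μβ,2} A_α + 2 g^{12} g^{αλ} A_{α,2}]_{,2}`
`- 2 (g^{12} g^{αλ} A_α)_{,2} g^{βμ} g_{μβ,2} - 2 g^{12} g^{αλ} A_α [g^{βμ} g_{μβ,2}]_{,2}`. -/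
def kA (K : Known 𝔤) (ε : Module.Basis (Fin N) ℝ 𝔤) (l : Fin 2) : Sp 3 → 𝔤 := fun y =>
  (4 * K.n y * K.g122 y) • K.w₂ ε l y
    + pdL ε 0 (fun z => (2 * K.tr2 z) • K.w l z + (2 : ℝ) • K.w₂ ε l z) y
    - (2 * K.tr2 y) • pdL ε 0 (K.w l) y
    - (2 * pd 0 K.tr2 y) • K.w l y

/-- The term `A_g`:
`-2 (g^{12} g^{αλ} A_α)_{,2} g_{12,λ} - 2 g^{12} g^{αλ} A_α g_{12,2λ}`
`- g^{βα} ([A_β, A_{α,2}] - g^{12} g_{12,β} A_{α,2})`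
`+ (g^{12} g^{αλ} A_α)_{,2} g₁₂ [g^{βμ} (g_{μλ,β} + g_{λβ,μ} - g_{μβ,λ})]`
`+ g^{12} g^{αλ} A_α (g₁₂ [g^{βμ} (g_{μλ,β} + g_{λβ,μ} - g_{μβ,λ})])_{,2}`
`- {g^{αβ} [g^{12} g_{12,β} + ½ g^{λμ} (g_{μβ,λ} + g_{λμ,β} - g_{βλ,μ})] + g^{αβ}_{,β}} A_{α,2}`
`+ (2 g^{12} g^{αλ} g_{12,λ} A_α - [g^{αδ} g^{βμ} (g_{μδ,β} + g_{δβ,μ} - g_{μβ,δ})] A_α)_{,2}`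
`- 2 g^{αβ} A_{α,2β} - 2 g^{12} g_{12,2} g^{αβ} A_{α,β} - g^{αβ}_{,2} A_{α,β}`. -/
def aG (K : Known 𝔤) (ε : Module.Basis (Fin N) ℝ 𝔤) : Sp 3 → 𝔤 := fun y =>
  -(∑ l, (2 * pd (gs l) K.g12 y) • pdL ε 0 (K.w l) y)
    - ∑ l, (2 * pd (gs l) K.g122 y) • K.w l y
    - ∑ b, ∑ a, K.u b a y • (⁅K.A b y, pdL ε 0 (K.A a) y⁆
        - (K.n y * pd (gs b) K.g12 y) • pdL ε 0 (K.A a) y)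
    + ∑ l, (K.g12 y * K.t l y) • pdL ε 0 (K.w l) y
    + ∑ l, pd 0 (fun z => K.g12 z * K.t l z) y • K.w l y
    - ∑ a, (∑ b, (K.u a b y * (K.n y * pd (gs b) K.g12 y
        + (1 / 2) * ∑ l, ∑ m, K.u l m y *
          (pd (gs l) (K.q m b) y + pd (gs b) (K.q l m) y - pd (gs m) (K.q b l) y))
        + pd (gs b) (K.u a b) y)) • pdL ε 0 (K.A a) y
    + pdL ε 0 (fun z => ∑ l, (2 * pd (gs l) K.g12 z) • K.w l z
        - ∑ a, (∑ d, K.u a d z * K.t d z) • K.A a z) y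
    - ∑ a, ∑ b, (2 * K.u a b y) • pdL ε (gs b) (pdL ε 0 (K.A a)) y
    - ∑ a, ∑ b, (2 * K.n y * K.g122 y * K.u a b y) • pdL ε (gs b) (K.A a) y
    - ∑ a, ∑ b, pd 0 (K.u a b) y • pdL ε (gs b) (K.A a) y

/-- `J₂ = [Φ, Φ_{,2}]`, the value of the current on `x¹ = 0` where `A₂ = 0`. -/
def j2 (K : Known 𝔤) (ε : Module.Basis (Fin N) ℝ 𝔤) : Sp 3 → 𝔤 := fun y =>
  ⁅K.Φ y, pdL ε 0 K.Φ y⁆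

/-- The right-hand side of the first combination, for the unknowns `z = (g₁₃, g₁₄)`:
`g^{12} g_{1α,22} + (g^{12})² g_{12,2} g_{1α,2} - g_{αβ,2} g^{βλ} g^{12} g_{1λ,2}`
`+ χ₀_α^λ g_{1λ} + c_α`. -/
def rhsR (K : Known 𝔤) (z : Fin 2 → Sp 3 → ℝ) (a : Fin 2) : Sp 3 → ℝ := fun y =>
  K.n y * pd 0 (pd 0 (z a)) y + K.n y ^ 2 * K.g122 y * pd 0 (z a) y
    - ∑ b, ∑ l, pd 0 (K.q a b) y * K.u b l y * K.n y * pd 0 (z l) y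
    + ∑ l, K.χ₀ a l y * z l y + K.c a y

/-- The right-hand side of the second combination, for the unknowns `X = A₁` and
`z = (g₁₃, g₁₄)`:
`-2 g^{12} A_{1,22} - 2 (g^{12})² g_{12,2} A_{1,2} + 2 g^{12} g^{αλ} A_{α,2} g_{1λ,2}`
`+ K^λ g_{1λ} + A_g`. -/
def rhsA (K : Known 𝔤) (ε : Module.Basis (Fin N) ℝ 𝔤) (X : Sp 3 → 𝔤) (z : Fin 2 → Sp 3 → ℝ) :
    Sp 3 → 𝔤 := fun y =>
  -((2 * K.n y) • pdL ε 0 (pdL ε 0 X) y) - (2 * K.n y ^ 2 * K.g122 y) • pdL ε 0 X y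
    + ∑ l, (2 * pd 0 (z l) y) • K.w₂ ε l y
    + ∑ l, z l y • K.kA ε l y + K.aG ε y

/-- `κ_α^λ = (g^{12})² g_{12,2} δ_α^λ - g^{12} g_{αβ,2} g^{βλ}`. -/
def κ (K : Known 𝔤) (a l : Fin 2) : Sp 3 → ℝ := fun y =>
  (if a = l then K.n y ^ 2 * K.g122 y else 0) - ∑ b, K.n y * pd 0 (K.q a b) y * K.u b l y

/-- `ϰ_α = 2 g^{12} A_{α,2}`. -/
def ϰ (K : Known 𝔤) (ε : Module.Basis (Fin N) ℝ 𝔤) (a : Fin 2) : Sp 3 → 𝔤 := fun y =>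
  (2 * K.n y) • pdL ε 0 (K.A a) y

/-- `χ_α^λ`: the coefficient `χ₀_α^λ` minus `2 g^{νλ} g^{12} A_{α,2}.A_{ν,2}`. -/
def χ (K : Known 𝔤) (ε : Module.Basis (Fin N) ℝ 𝔤) (B : LinearMap.BilinForm ℝ 𝔤)
    (a l : Fin 2) : Sp 3 → ℝ := fun y =>
  K.χ₀ a l y
    - 2 * ∑ v, K.u v l y * K.n y * B (pdL ε 0 (K.A a) y) (pdL ε 0 (K.A v) y)

/-- `Ϝ_α = c_α + g^{βλ} (A_{α,λ} - A_{λ,α} + [A_λ, A_α]).A_{β,2} + g^{μν} A_{α,2}.A_{μ,ν}`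
`- Φ_{,2}.(Φ_{,α} + [A_α, Φ])`. -/
def dig (K : Known 𝔤) (ε : Module.Basis (Fin N) ℝ 𝔤) (B : LinearMap.BilinForm ℝ 𝔤)
    (a : Fin 2) : Sp 3 → ℝ := fun y =>
  K.c a y
    + ∑ b, ∑ l, K.u b l y * B (pdL ε (gs l) (K.A a) y - pdL ε (gs a) (K.A l) y
        + ⁅K.A l y, K.A a y⁆) (pdL ε 0 (K.A b) y)
    + ∑ m, ∑ v, K.u m v y * B (pdL ε 0 (K.A a) y) (pdL ε (gs v) (K.A m) y)
    - B (pdL ε 0 K.Φ y) (pdL ε (gs a) K.Φ y + ⁅K.A a y, K.Φ y⁆)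

/-- `b = A_g - J₂`. -/
def bA (K : Known 𝔤) (ε : Module.Basis (Fin N) ℝ 𝔤) : Sp 3 → 𝔤 := fun y =>
  K.aG ε y - K.j2 ε y

/-- The linear second order system of ordinary differential equations in the variable `x²` for
the unknowns `X = A₁` and `z = (g₁₃, g₁₄)`, at the point `y`, with coefficients that are
computed from the known quantities only:
`g^{12} g_{1α,22} + κ_α^λ g_{1λ,2} + ϰ_α.A_{1,2} + χ_α^λ g_{1λ} + Ϝ_α = 0` for `α = 3, 4`, and
`-2 g^{12} A_{1,22} - 2 (g^{12})² g_{12,2} A_{1,2} + 2 g^{12} g^{αλ} A_{α,2} g_{1λ,2}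
+ a^λ g_{1λ} + b = 0` with `a^λ = K^λ`. -/
def LinearODE (K : Known 𝔤) (ε : Module.Basis (Fin N) ℝ 𝔤) (B : LinearMap.BilinForm ℝ 𝔤)
    (X : Sp 3 → 𝔤) (z : Fin 2 → Sp 3 → ℝ) (y : Sp 3) : Prop :=
  (∀ a : Fin 2,
    K.n y * pd 0 (pd 0 (z a)) y + ∑ l, K.κ a l y * pd 0 (z l) y + B (K.ϰ ε a y) (pdL ε 0 X y)
      + ∑ l, K.χ ε B a l y * z l y + K.dig ε B a y = 0) ∧
  -((2 * K.n y) • pdL ε 0 (pdL ε 0 X) y) - (2 * K.n y ^ 2 * K.g122 y) • pdL ε 0 X y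
    + ∑ l, pd 0 (z l) y • ((2 : ℝ) • K.w₂ ε l y)
    + ∑ l, z l y • K.kA ε l y + K.bA ε y = 0

end Known

end ThreeDim

end EYMH

end

/-!
On `{x¹ = 0}` one has `g¹¹ = g¹³ = g¹⁴ = 0`, so the unknown transversal derivatives that survive are
`g_{2α,1}` in `Γ²_{2α}` and `g_{αβ} Γ^β`, and `A_{2,1}` in `F²¹` and `Δ`. They cancel in
`m = Γ²_{2α} + ½ g_{αβ} Γ^β` and in `m = g₁₂ F²¹ - (Δ + Γ^γ A_γ)`, and with `ν = g¹² g_{12,2}` both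
left-hand sides of (i) are `m_{,2} + 2 ν m` up to known terms. The condition on `Ω` enters as
`g^{αβ} g_{αβ,2} = 4 ν`, which makes `Γ¹` vanish. In (ii) the derivative `A_{2,1}` occurs in
`τ_{2α}` and in the added term `A_{α,2} . (Δ + Γ^γ A_γ)`; it cancels because their difference
contains the second combination `m` again.
-/

noncomputable section

namespace EYMH

open scoped Topology

section Calculus

variable {n : ℕ} {f g : Sp n → ℝ} {x : Sp n}

@[fun_prop]
lemma differentiableAt_of_contDiffAt (hf : ContDiffAt ℝ ∞ f x) : DifferentiableAt ℝ f x :=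
  hf.differentiableAt (by simp)

@[fun_prop]
lemma contDiffAt_pd {i : Fin n} (hf : ContDiffAt ℝ ∞ f x) : ContDiffAt ℝ ∞ (pd i f) x :=
  (hf.fderiv_right (m := ∞) (by simp)).clm_apply contDiffAt_const

lemma pd_const (i : Fin n) (c : ℝ) (x : Sp n) : pd i (fun _ => c) x = 0 := by
  simp [pd]

lemma pd_add (i : Fin n) (hf : DifferentiableAt ℝ f x) (hg : DifferentiableAt ℝ g x) :
    pd i (fun z => f z + g z) x = pd i f x + pd i g x := by
  simp [pd, fderiv_fun_add hf hg]

lemma pd_sub (i : Fin n) (hf : DifferentiableAt ℝ f x) (hg : DifferentiableAt ℝ g x) :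
    pd i (fun z => f z - g z) x = pd i f x - pd i g x := by
  simp [pd, fderiv_fun_sub hf hg]

lemma pd_mul (i : Fin n) (hf : DifferentiableAt ℝ f x) (hg : DifferentiableAt ℝ g x) :
    pd i (fun z => f z * g z) x = pd i f x * g x + f x * pd i g x := by
  simp only [pd, fderiv_fun_mul hf hg, add_apply, smul_apply, smul_eq_mul]
  ring

lemma pd_sum {ι : Type*} [Fintype ι] (i : Fin n) {f : ι → Sp n → ℝ}
    (hf : ∀ k, DifferentiableAt ℝ (f k) x) :
    pd i (fun z => ∑ k, f k z) x = ∑ k, pd i (f k) x := by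
  simp [pd, fderiv_fun_sum (fun k _ => hf k)]

lemma pd_inv (i : Fin n) (hf : DifferentiableAt ℝ f x) (h0 : f x ≠ 0) :
    pd i (fun z => (f z)⁻¹) x = -(f x)⁻¹ ^ 2 * pd i f x := by
  have h := ((hasDerivAt_inv h0).comp_hasFDerivAt x hf.hasFDerivAt).fderiv
  simp only [Function.comp_def] at h
  simp [pd, h]

lemma pd_congr (i : Fin n) (h : f =ᶠ[𝓝 x] g) : pd i f x = pd i g x := by
  simp [pd, h.fderiv_eq]

lemma pd_congr_of_eqOn {U : Set (Sp n)} (i : Fin n) (hU : U ∈ 𝓝 x) (h : Set.EqOn f g U) :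
    pd i f x = pd i g x :=
  pd_congr i (h.eventuallyEq_of_mem hU)

lemma pd_comm (i j : Fin n) (hf : ContDiffAt ℝ ∞ f x) : pd i (pd j f) x = pd j (pd i f) x := by
  have hf : ContDiffAt ℝ 2 f x := hf.of_le (WithTop.coe_le_coe.2 (le_top : (2 : ℕ∞) ≤ ⊤))
  have hd : DifferentiableAt ℝ (fderiv ℝ f) x :=
    (hf.fderiv_right (m := 1) (by norm_num)).differentiableAt one_ne_zero
  have pd_pd : ∀ i j : Fin n, pd i (pd j f) x =
      fderiv ℝ (fderiv ℝ f) x (Pi.single i 1) (Pi.single j 1) := by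
    intro i j
    have h : pd j f = fun z => fderiv ℝ f z (Pi.single j 1) := rfl
    rw [pd, h, fderiv_clm_apply hd (differentiableAt_const _)]
    simp
  rw [pd_pd, pd_pd]
  exact (hf.isSymmSndFDerivAt (by simp)) _ _

lemma pd_eq_of_eqOn {S : Set (Sp n)} (i : Fin n) (hx : x ∈ closure (interior S))
    (h : Set.EqOn f g S) (hf : ContDiffAt ℝ ∞ f x) (hg : ContDiffAt ℝ ∞ g x) :
    pd i f x = pd i g x := by
  have hS : Set.EqOn (pd i f) (pd i g) (interior S) := fun z hz =>
    pd_congr_of_eqOn i (mem_interior_iff_mem_nhds.1 hz) h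
  have : (𝓝[interior S] x).NeBot := mem_closure_iff_nhdsWithin_neBot.1 hx
  have hf' : ContinuousAt (pd i f) x := (contDiffAt_pd hf).continuousAt
  have hg' : ContinuousAt (pd i g) x := (contDiffAt_pd hg).continuousAt
  exact tendsto_nhds_unique_of_eventuallyEq hf'.continuousWithinAt.tendsto
    hg'.continuousWithinAt.tendsto (hS.eventuallyEq_of_mem self_mem_nhdsWithin)

end Calculus

section Hyperplane

/-- `emb` as a continuous linear map. -/
def embL : Sp 3 →L[ℝ] Sp 4 :=
  ContinuousLinearMap.pi (Fin.cons 0 fun i => ContinuousLinearMap.proj i)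

lemma embL_apply (y : Sp 3) : embL y = emb y := by
  funext i
  refine Fin.cases ?_ (fun j => ?_) i <;> simp [embL, emb]

lemma embL_single (i : Fin 3) : embL (Pi.single i 1) = Pi.single i.succ (1 : ℝ) := by
  rw [embL_apply]
  funext j
  refine Fin.cases ?_ (fun j => ?_) j
  · simp [emb, (Fin.succ_ne_zero _).symm]
  · simp [emb, Pi.single_apply]

lemma contDiff_emb : ContDiff ℝ ∞ emb :=
  (funext embL_apply : ⇑embL = emb) ▸ embL.contDiff

variable {f : Sp 4 → ℝ} {y : Sp 3}

lemma contDiffAt_comp_emb (hf : ContDiffAt ℝ ∞ f (emb y)) :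
    ContDiffAt ℝ ∞ (fun z => f (emb z)) y :=
  hf.comp y contDiff_emb.contDiffAt

lemma pd_comp_emb (i : Fin 3) (hf : DifferentiableAt ℝ f (emb y)) :
    pd i (fun y => f (emb y)) y = pd i.succ f (emb y) := by
  have h : (fun y => f (emb y)) = f ∘ embL := funext fun y => by simp [embL_apply]
  rw [← embL_apply] at hf
  simp only [pd, h]
  rw [fderiv_comp _ hf embL.differentiableAt, embL.fderiv, ContinuousLinearMap.comp_apply,
    embL_single, embL_apply]

end Hyperplane

section VectorValued

variable {n N : ℕ} {𝔤 : Type*} [AddCommGroup 𝔤] [Module ℝ 𝔤] {ε : Module.Basis (Fin N) ℝ 𝔤}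
  {f g : Sp n → 𝔤} {c : Sp n → ℝ} {x : Sp n}

/-- A vector-valued function is smooth at `x` if its components in the basis `ε` are; the vector
space carries no topology here, only the basis that also enters `pdL`. -/
@[fun_prop]
def SmoothAt (ε : Module.Basis (Fin N) ℝ 𝔤) (f : Sp n → 𝔤) (x : Sp n) : Prop :=
  ∀ I, ContDiffAt ℝ ∞ (fun z => ε.repr (f z) I) x

lemma repr_pdL (i : Fin n) (f : Sp n → 𝔤) (x : Sp n) (I : Fin N) :
    ε.repr (pdL ε i f x) I = pd i (fun z => ε.repr (f z) I) x := by
  simp only [pdL, Module.Basis.repr_sum_self]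

namespace SmoothAt

@[fun_prop]
lemma add (hf : SmoothAt ε f x) (hg : SmoothAt ε g x) : SmoothAt ε (fun z => f z + g z) x :=
  fun I => by simpa using (hf I).add (hg I)

@[fun_prop]
lemma sub (hf : SmoothAt ε f x) (hg : SmoothAt ε g x) : SmoothAt ε (fun z => f z - g z) x :=
  fun I => by simpa using (hf I).sub (hg I)

@[fun_prop]
lemma smul (hc : ContDiffAt ℝ ∞ c x) (hf : SmoothAt ε f x) : SmoothAt ε (fun z => c z • f z) x :=
  fun I => by simpa using hc.mul (hf I)

@[fun_prop]
lemma sum {ι : Type*} [Fintype ι] {f : ι → Sp n → 𝔤} (hf : ∀ k, SmoothAt ε (f k) x) :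
    SmoothAt ε (fun z => ∑ k, f k z) x :=
  fun I => by simpa using ContDiffAt.sum fun k _ => hf k I

@[fun_prop]
lemma pdL {i : Fin n} (hf : SmoothAt ε f x) : SmoothAt ε (pdL ε i f) x :=
  fun I => by simpa only [repr_pdL] using contDiffAt_pd (hf I)

lemma comp_emb {f : Sp 4 → 𝔤} {y : Sp 3} (hf : SmoothAt ε f (emb y)) :
    SmoothAt ε (fun z => f (emb z)) y :=
  fun I => contDiffAt_comp_emb (hf I)

end SmoothAt

variable (i : Fin n)

lemma pdL_zero : pdL ε i (fun _ => 0) x = 0 := by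
  simp [pdL, pd_const]

lemma pdL_add (hf : SmoothAt ε f x) (hg : SmoothAt ε g x) :
    pdL ε i (fun z => f z + g z) x = pdL ε i f x + pdL ε i g x :=
  ε.ext_elem fun I => by
    simp only [repr_pdL, map_add, Finsupp.add_apply]
    exact pd_add i (differentiableAt_of_contDiffAt (hf I)) (differentiableAt_of_contDiffAt (hg I))

lemma pdL_sub (hf : SmoothAt ε f x) (hg : SmoothAt ε g x) :
    pdL ε i (fun z => f z - g z) x = pdL ε i f x - pdL ε i g x :=
  ε.ext_elem fun I => by
    simp only [repr_pdL, map_sub, Finsupp.sub_apply]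
    exact pd_sub i (differentiableAt_of_contDiffAt (hf I)) (differentiableAt_of_contDiffAt (hg I))

lemma pdL_smul (hc : ContDiffAt ℝ ∞ c x) (hf : SmoothAt ε f x) :
    pdL ε i (fun z => c z • f z) x = pd i c x • f x + c x • pdL ε i f x :=
  ε.ext_elem fun I => by
    simp only [repr_pdL, map_add, map_smul, Finsupp.add_apply, Finsupp.smul_apply, smul_eq_mul]
    exact pd_mul i (differentiableAt_of_contDiffAt hc) (differentiableAt_of_contDiffAt (hf I))

lemma pdL_sum {ι : Type*} [Fintype ι] {f : ι → Sp n → 𝔤} (hf : ∀ k, SmoothAt ε (f k) x) :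
    pdL ε i (fun z => ∑ k, f k z) x = ∑ k, pdL ε i (f k) x :=
  ε.ext_elem fun I => by
    simp only [repr_pdL, map_sum, Finsupp.coe_finsetSum, Finset.sum_apply]
    exact pd_sum i fun k => differentiableAt_of_contDiffAt (hf k I)

lemma pdL_congr (h : f =ᶠ[𝓝 x] g) : pdL ε i f x = pdL ε i g x :=
  ε.ext_elem fun I => by
    simpa only [repr_pdL] using pd_congr i (h.mono fun z hz => by simp only [hz])

lemma pdL_congr_of_eqOn {U : Set (Sp n)} (hU : U ∈ 𝓝 x) (h : Set.EqOn f g U) :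
    pdL ε i f x = pdL ε i g x :=
  pdL_congr i (h.eventuallyEq_of_mem hU)

lemma pdL_comm (j : Fin n) (hf : SmoothAt ε f x) :
    pdL ε i (pdL ε j f) x = pdL ε j (pdL ε i f) x :=
  ε.ext_elem fun I => by
    simpa only [repr_pdL] using pd_comm i j (hf I)

lemma pdL_eq_of_eqOn {S : Set (Sp n)} (hx : x ∈ closure (interior S)) (h : Set.EqOn f g S)
    (hf : SmoothAt ε f x) (hg : SmoothAt ε g x) : pdL ε i f x = pdL ε i g x :=
  ε.ext_elem fun I => by
    simpa only [repr_pdL] using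
      pd_eq_of_eqOn i hx (fun z hz => by simp only [h hz]) (hf I) (hg I)

lemma pdL_comp_emb {f : Sp 4 → 𝔤} {y : Sp 3} (i : Fin 3) (hf : SmoothAt ε f (emb y)) :
    pdL ε i (fun z => f (emb z)) y = pdL ε i.succ f (emb y) :=
  ε.ext_elem fun I => by
    simpa only [repr_pdL] using pd_comp_emb i (differentiableAt_of_contDiffAt (hf I))

end VectorValued

section LieValued

variable {n N : ℕ} {𝔤 : Type*} [LieRing 𝔤] [LieAlgebra ℝ 𝔤] {ε : Module.Basis (Fin N) ℝ 𝔤}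

lemma repr_lie (a b : 𝔤) (I : Fin N) :
    ε.repr ⁅a, b⁆ I = ∑ J, ∑ K, ε.repr a J * ε.repr b K * ε.repr ⁅ε J, ε K⁆ I := by
  conv_lhs => rw [← ε.sum_repr a, ← ε.sum_repr b]
  simp only [sum_lie, lie_sum, smul_lie, lie_smul, map_sum,
    map_smul, Finsupp.coe_finsetSum, Finset.sum_apply, Finsupp.smul_apply, smul_eq_mul,
    Finset.smul_sum, mul_assoc]
  rw [Finset.sum_comm]
  exact Finset.sum_congr rfl fun J _ => Finset.sum_congr rfl fun K _ => by ring

@[fun_prop]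
lemma SmoothAt.lie {f g : Sp n → 𝔤} {x : Sp n} (hf : SmoothAt ε f x) (hg : SmoothAt ε g x) :
    SmoothAt ε (fun z => ⁅f z, g z⁆) x := fun I => by
  have hf' : ∀ J, ContDiffAt ℝ ∞ (fun z => ε.repr (f z) J) x := hf
  have hg' : ∀ J, ContDiffAt ℝ ∞ (fun z => ε.repr (g z) J) x := hg
  simp only [repr_lie (f _)]
  fun_prop

end LieValued

section MatrixValued

lemma sum_mul_inv_apply {ι R : Type*} [Fintype ι] [DecidableEq ι] [CommRing R]
    {M : Matrix ι ι R} (hM : IsUnit M.det) (i k : ι) :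
    ∑ j, M i j * M⁻¹ j k = if i = k then 1 else 0 := by
  rw [← Matrix.mul_apply, M.mul_nonsing_inv hM, Matrix.one_apply]

lemma sum_inv_mul_apply {ι R : Type*} [Fintype ι] [DecidableEq ι] [CommRing R]
    {M : Matrix ι ι R} (hM : IsUnit M.det) (i k : ι) :
    ∑ j, M⁻¹ i j * M j k = if i = k then 1 else 0 := by
  rw [← Matrix.mul_apply, M.nonsing_inv_mul hM, Matrix.one_apply]

lemma sum_mul_sum_eq_of_inverse {ι R : Type*} [Fintype ι] [DecidableEq ι] [CommSemiring R]
    {p q : ι → ι → R} (h : ∀ i k, ∑ j, p i j * q j k = if i = k then 1 else 0) (v : ι → R) (i : ι) :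
    ∑ j, p i j * ∑ k, q j k * v k = v i := by
  simp only [Finset.mul_sum, ← mul_assoc]
  rw [Finset.sum_comm]
  simp [← Finset.sum_mul, h]

section Smooth

variable {E ι : Type*} [NormedAddCommGroup E] [NormedSpace ℝ E] [Fintype ι] [DecidableEq ι]
  {M : ι → ι → E → ℝ} {x : E}

lemma contDiffAt_det (hM : ∀ i j, ContDiffAt ℝ ∞ (M i j) x) :
    ContDiffAt ℝ ∞ (fun z => (Matrix.of fun i j => M i j z).det) x := by
  simp only [Matrix.det_apply, Matrix.of_apply]
  fun_prop

lemma contDiffAt_matrix_inv (hM : ∀ i j, ContDiffAt ℝ ∞ (M i j) x)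
    (h0 : (Matrix.of fun i j => M i j x).det ≠ 0) (a b : ι) :
    ContDiffAt ℝ ∞ (fun z => (Matrix.of fun i j => M i j z)⁻¹ a b) x := by
  have hadj : ContDiffAt ℝ ∞ (fun z => (Matrix.of fun i j => M i j z).adjugate a b) x := by
    have h : (fun z => (Matrix.of fun i j => M i j z).adjugate a b) = fun z =>
        (Matrix.of fun i j =>
          (if i = b then fun _ => (Pi.single a 1 : ι → ℝ) j else M i j) z).det := by
      funext z
      rw [Matrix.adjugate_apply]
      congr 1
      ext i j
      by_cases hi : i = b <;> simp [hi]
    rw [h]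
    refine contDiffAt_det fun i j => ?_
    by_cases hi : i = b
    · simpa only [hi, if_true] using contDiffAt_const
    · simpa only [hi, if_false] using hM i j
  simpa [Matrix.inv_def, Ring.inverse_eq_inv'] using ((contDiffAt_det hM).inv h0).mul hadj

end Smooth

variable {ι : Type*} [Fintype ι] [DecidableEq ι] {n : ℕ} {p q : ι → ι → Sp n → ℝ} {x : Sp n}

lemma sum_mul_pd_of_inverse (i : Fin n) (hp : ∀ a b, DifferentiableAt ℝ (p a b) x)
    (hq : ∀ a b, DifferentiableAt ℝ (q a b) x)
    (h : ∀ᶠ z in 𝓝 x, ∀ a c, ∑ b, p a b z * q b c z = if a = c then 1 else 0) (a c : ι) :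
    ∑ b, p a b x * pd i (q b c) x = -∑ b, pd i (p a b) x * q b c x := by
  have hprod : pd i (fun z => ∑ b, p a b z * q b c z) x = 0 :=
    (pd_congr i (h.mono fun z hz => hz a c)).trans (pd_const i _ x)
  simp (disch := fun_prop) only [pd_sum, pd_mul, Finset.sum_add_distrib] at hprod
  linarith

lemma pd_of_inverse (i : Fin n) (hp : ∀ a b, DifferentiableAt ℝ (p a b) x)
    (hq : ∀ a b, DifferentiableAt ℝ (q a b) x)
    (h : ∀ᶠ z in 𝓝 x, ∀ a c, ∑ b, p a b z * q b c z = if a = c then 1 else 0)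
    (h' : ∀ a c, ∑ b, q a b x * p b c x = if a = c then 1 else 0) (a c : ι) :
    pd i (q a c) x = -∑ b, q a b x * ∑ d, pd i (p b d) x * q d c x := by
  rw [← sum_mul_sum_eq_of_inverse h' (fun d => pd i (q d c) x) a]
  simp only [sum_mul_pd_of_inverse i hp hq h, mul_neg, Finset.sum_neg_distrib]

lemma pd_det_fin_two {q : Fin 2 → Fin 2 → Sp n → ℝ} (i : Fin n)
    (hq : ∀ a b, ContDiffAt ℝ ∞ (q a b) x) (h0 : (Matrix.of fun a b => q a b x).det ≠ 0) :
    pd i (fun z => (Matrix.of fun a b => q a b z).det) x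
      = (Matrix.of fun a b => q a b x).det
        * ∑ b, ∑ a, (Matrix.of fun k l => q k l x)⁻¹ b a * pd i (q a b) x := by
  simp (disch := fun_prop) only [Matrix.det_fin_two, Matrix.of_apply, pd_sub, pd_mul,
    Matrix.inv_def, Ring.inverse_eq_inv', Matrix.adjugate_fin_two, Fin.sum_univ_two,
    Matrix.smul_apply, Matrix.cons_val', smul_eq_mul, Matrix.cons_val_zero, Matrix.cons_val_one,
    Matrix.cons_val_fin_one, mul_assoc, ← mul_add] at h0 ⊢
  rw [mul_inv_cancel_left₀ h0]
  ring

end MatrixValued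

/-! ### The right-hand sides as transport expressions -/

namespace Known

variable {𝔤 : Type*}

/-- On the open set `W` of the hyperplane the known metric components are smooth, `g₁₂` does not
vanish and `(g_{αβ})` is symmetric and nondegenerate. -/
structure MetricOn (K : Known 𝔤) (W : Set (Sp 3)) : Prop where
  isOpen : IsOpen W
  smooth_g12 : ContDiffOn ℝ ∞ K.g12 W
  smooth_q : ∀ a b, ContDiffOn ℝ ∞ (K.q a b) W
  g12_ne : ∀ y ∈ W, K.g12 y ≠ 0
  det_q_ne : ∀ y ∈ W, (Matrix.of fun a b => K.q a b y).det ≠ 0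
  symm_q : ∀ a b, ∀ y ∈ W, K.q a b y = K.q b a y

/-- `ν = g^{12} g_{12,2}`; the transport operator of the characteristic hyperplane acting on a
quantity `m` is `m_{,2} + 2 ν m`. -/
def ν (K : Known 𝔤) : Sp 3 → ℝ := fun y => K.n y * K.g122 y

/-- The null second fundamental form `½ g^{βγ} g_{αγ,2}` of the hyperplane, which is `Γ^β_{2α}`. -/
def nullShape (K : Known 𝔤) (b a : Fin 2) : Sp 3 → ℝ := fun y =>
  (1 / 2) * ∑ c, K.u b c y * pd 0 (K.q a c) y

/-- The derivative `(log √|det g|)_{,γ} = Γ^k_{kγ}` of the volume density of the space-time. -/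
def logVolDeriv (K : Known 𝔤) (c : Fin 2) : Sp 3 → ℝ := fun y =>
  K.n y * pd (gs c) K.g12 y + (1 / 2) * ∑ b, ∑ d, K.u b d y * pd (gs c) (K.q b d) y

/-- The quantity `g^{12} (z_{α,2} - g_{αβ,2} g^{βλ} z_λ)` that is transported along the null
direction by the Ricci components `R_{2α}`, for the unknowns `z = (g₁₃, g₁₄)`. -/
def shiftRate (K : Known 𝔤) (z : Fin 2 → Sp 3 → ℝ) (a : Fin 2) : Sp 3 → ℝ := fun y =>
  K.n y * (pd 0 (z a) y - ∑ b, ∑ l, pd 0 (K.q a b) y * K.u b l y * z l y)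

namespace MetricOn

variable {K : Known 𝔤} {W : Set (Sp 3)} {y : Sp 3}

lemma contDiffAt_g12 (hK : K.MetricOn W) (hy : y ∈ W) : ContDiffAt ℝ ∞ K.g12 y :=
  hK.smooth_g12.contDiffAt (hK.isOpen.mem_nhds hy)

lemma contDiffAt_q (hK : K.MetricOn W) (hy : y ∈ W) (a b : Fin 2) : ContDiffAt ℝ ∞ (K.q a b) y :=
  (hK.smooth_q a b).contDiffAt (hK.isOpen.mem_nhds hy)

lemma contDiffAt_n (hK : K.MetricOn W) (hy : y ∈ W) : ContDiffAt ℝ ∞ K.n y :=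
  (hK.contDiffAt_g12 hy).inv (hK.g12_ne y hy)

lemma contDiffAt_u (hK : K.MetricOn W) (hy : y ∈ W) (a b : Fin 2) : ContDiffAt ℝ ∞ (K.u a b) y :=
  contDiffAt_matrix_inv (hK.contDiffAt_q hy) (hK.det_q_ne y hy) a b

lemma contDiffAt_ν (hK : K.MetricOn W) (hy : y ∈ W) : ContDiffAt ℝ ∞ K.ν y :=
  (hK.contDiffAt_n hy).mul (contDiffAt_pd (hK.contDiffAt_g12 hy))

lemma contDiffAt_nullShape (hK : K.MetricOn W) (hy : y ∈ W) (b a : Fin 2) :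
    ContDiffAt ℝ ∞ (K.nullShape b a) y := by
  have hu := hK.contDiffAt_u hy
  have hq := hK.contDiffAt_q hy
  unfold nullShape
  fun_prop

lemma contDiffAt_s (hK : K.MetricOn W) (hy : y ∈ W) (a : Fin 2) : ContDiffAt ℝ ∞ (K.s a) y := by
  have hu := hK.contDiffAt_u hy
  have hq := hK.contDiffAt_q hy
  unfold s
  fun_prop

lemma contDiffAt_br (hK : K.MetricOn W) (hy : y ∈ W) (b : Fin 2) : ContDiffAt ℝ ∞ (K.br b) y := by
  have hu := hK.contDiffAt_u hy
  have hn := hK.contDiffAt_n hy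
  have hs := hK.contDiffAt_s hy
  have hg12 := hK.contDiffAt_g12 hy
  unfold br
  fun_prop

lemma contDiffAt_tr2 (hK : K.MetricOn W) (hy : y ∈ W) : ContDiffAt ℝ ∞ K.tr2 y := by
  have hu := hK.contDiffAt_u hy
  have hq := hK.contDiffAt_q hy
  unfold tr2
  fun_prop

lemma contDiffAt_t (hK : K.MetricOn W) (hy : y ∈ W) (l : Fin 2) : ContDiffAt ℝ ∞ (K.t l) y := by
  have hu := hK.contDiffAt_u hy
  have hq := hK.contDiffAt_q hy
  unfold t
  fun_prop

lemma n_mul_g12 (hK : K.MetricOn W) (hy : y ∈ W) : K.n y * K.g12 y = 1 :=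
  inv_mul_cancel₀ (hK.g12_ne y hy)

lemma g12_mul_ν (hK : K.MetricOn W) (hy : y ∈ W) : K.g12 y * K.ν y = K.g122 y :=
  mul_inv_cancel_left₀ (hK.g12_ne y hy) _

lemma sum_q_mul_u (hK : K.MetricOn W) (hy : y ∈ W) (a c : Fin 2) :
    ∑ b, K.q a b y * K.u b c y = if a = c then 1 else 0 :=
  sum_mul_inv_apply (hK.det_q_ne y hy).isUnit a c

lemma sum_u_mul_q (hK : K.MetricOn W) (hy : y ∈ W) (a c : Fin 2) :
    ∑ b, K.u a b y * K.q b c y = if a = c then 1 else 0 :=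
  sum_inv_mul_apply (hK.det_q_ne y hy).isUnit a c

lemma u_symm (hK : K.MetricOn W) (hy : y ∈ W) (a b : Fin 2) : K.u a b y = K.u b a y :=
  (Matrix.IsSymm.ext fun c d => hK.symm_q d c y hy).inv.apply b a

lemma pd_q_symm (hK : K.MetricOn W) (hy : y ∈ W) (i : Fin 3) (a b : Fin 2) :
    pd i (K.q a b) y = pd i (K.q b a) y :=
  pd_congr_of_eqOn i (hK.isOpen.mem_nhds hy) (hK.symm_q a b)

lemma pd_n (hK : K.MetricOn W) (hy : y ∈ W) (i : Fin 3) :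
    pd i K.n y = -K.n y ^ 2 * pd i K.g12 y :=
  pd_inv i (differentiableAt_of_contDiffAt (hK.contDiffAt_g12 hy)) (hK.g12_ne y hy)

lemma pd_zero_n (hK : K.MetricOn W) (hy : y ∈ W) : pd 0 K.n y = -K.n y * K.ν y := by
  rw [hK.pd_n hy, ν, g122]
  ring

lemma sum_q_mul_pd_u (hK : K.MetricOn W) (hy : y ∈ W) (i : Fin 3) (a c : Fin 2) :
    ∑ b, K.q a b y * pd i (K.u b c) y = -∑ b, pd i (K.q a b) y * K.u b c y :=
  sum_mul_pd_of_inverse i (fun a b => differentiableAt_of_contDiffAt (hK.contDiffAt_q hy a b))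
    (fun a b => differentiableAt_of_contDiffAt (hK.contDiffAt_u hy a b))
    (Filter.eventually_of_mem (hK.isOpen.mem_nhds hy) fun _ hz => hK.sum_q_mul_u hz) a c

lemma pd_u (hK : K.MetricOn W) (hy : y ∈ W) (i : Fin 3) (a c : Fin 2) :
    pd i (K.u a c) y = -∑ b, K.u a b y * ∑ d, pd i (K.q b d) y * K.u d c y :=
  pd_of_inverse i (fun a b => differentiableAt_of_contDiffAt (hK.contDiffAt_q hy a b))
    (fun a b => differentiableAt_of_contDiffAt (hK.contDiffAt_u hy a b))
    (Filter.eventually_of_mem (hK.isOpen.mem_nhds hy) fun _ hz => hK.sum_q_mul_u hz)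
    (hK.sum_u_mul_q hy) a c

lemma sum_q_mul_pd_pd_u (hK : K.MetricOn W) (hy : y ∈ W) (i : Fin 3) (a c : Fin 2) :
    ∑ b, K.q a b y * pd i (pd i (K.u b c)) y =
      -∑ b, (2 * pd i (K.q a b) y * pd i (K.u b c) y + pd i (pd i (K.q a b)) y * K.u b c y) := by
  have hq := hK.contDiffAt_q hy
  have hu := hK.contDiffAt_u hy
  have hzero : pd i (fun z => ∑ b, K.q a b z * pd i (K.u b c) z
      + ∑ b, pd i (K.q a b) z * K.u b c z) y = 0 :=
    (pd_congr_of_eqOn i (hK.isOpen.mem_nhds hy) fun z hz => by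
      rw [hK.sum_q_mul_pd_u hz, neg_add_cancel]).trans (pd_const i 0 y)
  simp (disch := fun_prop) only [pd_add, pd_mul, Fin.sum_univ_two] at hzero ⊢
  linear_combination hzero

lemma χ₀_eq (hK : K.MetricOn W) (hy : y ∈ W) (a l : Fin 2) :
    K.χ₀ a l y = -K.n y * ∑ b, (K.ν y * pd 0 (K.q a b) y * K.u b l y
      + pd 0 (K.q a b) y * pd 0 (K.u b l) y + pd 0 (pd 0 (K.q a b)) y * K.u b l y) := by
  have hfirst := hK.sum_q_mul_pd_u hy 0 a l
  have hsecond := hK.sum_q_mul_pd_pd_u hy 0 a l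
  simp only [χ₀, ν, Fin.sum_univ_two] at hfirst hsecond ⊢
  linear_combination K.n y ^ 2 * K.g122 y * hfirst + (1 / 2) * K.n y * hsecond

lemma sum_q_mul_br (hK : K.MetricOn W) (hy : y ∈ W) (a : Fin 2) :
    ∑ b, K.q a b y * K.br b y = -2 * K.n y * pd (gs a) K.g12 y + K.s a y := by
  have hbr : ∀ b, K.br b y = ∑ l, K.u b l y * (-2 * K.n y * pd (gs l) K.g12 y + K.s l y) :=
    fun b => Finset.sum_congr rfl fun l _ => by ring
  simp only [hbr]
  exact sum_mul_sum_eq_of_inverse (hK.sum_q_mul_u hy) _ a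

lemma sum_pd_q_mul_br (hK : K.MetricOn W) (hy : y ∈ W) (a : Fin 2) :
    ∑ b, (pd 0 (K.q a b) y * K.br b y + K.q a b y * pd 0 (K.br b) y)
      = 2 * K.n y * K.ν y * pd (gs a) K.g12 y - 2 * K.n y * pd (gs a) K.g122 y
        + pd 0 (K.s a) y := by
  have hq := hK.contDiffAt_q hy
  have hbr := hK.contDiffAt_br hy
  have hn := hK.contDiffAt_n hy
  have hg12 := hK.contDiffAt_g12 hy
  have hs := hK.contDiffAt_s hy
  have hcomm : pd 0 (pd (gs a) K.g12) y = pd (gs a) K.g122 y :=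
    pd_comm _ _ hg12
  have h := pd_congr_of_eqOn 0 (hK.isOpen.mem_nhds hy) fun z hz => hK.sum_q_mul_br hz a
  simp (disch := fun_prop) only [pd_sum, pd_add, pd_mul, pd_const, hK.pd_zero_n hy, hcomm] at h
  rw [h]
  ring

lemma c_eq (hK : K.MetricOn W) (hy : y ∈ W) (a : Fin 2) :
    K.c a y = (1 / 4) * pd 0 (K.s a) y + (1 / 2) * K.ν y * K.s a y
      - K.n y * K.ν y * pd (gs a) K.g12 y + K.n y * pd (gs a) K.g122 y - 3 * pd (gs a) K.ν y
      + ∑ b, pd (gs b) (K.nullShape b a) y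
      + (1 / 2) * ∑ l, K.nullShape l a y * ∑ m, ∑ t, K.u m t y * pd (gs l) (K.q m t) y
      + (1 / 4) * ∑ b, ∑ l, pd 0 (K.u b l) y * pd (gs a) (K.q l b) y := by
  have hu := hK.contDiffAt_u hy
  have hq := hK.contDiffAt_q hy
  have hg12 := hK.contDiffAt_g12 hy
  have hdiv : ∀ l, (1 / 2) * ∑ b, pd (gs l) (fun z => K.u l b z * pd 0 (K.q a b) z) y
      = pd (gs l) (K.nullShape l a) y := fun l => by
    unfold nullShape
    simp (disch := fun_prop) only [pd_mul, pd_sum, pd_const, zero_mul, zero_add]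
  have hg221 : pd (gs a) K.g221 y = 2 * pd (gs a) K.g122 y := by
    unfold g221 g122
    simp (disch := fun_prop) only [pd_mul, pd_const, zero_mul, zero_add]
  have hν : pd (gs a) (fun z => K.n z * K.g122 z) y = pd (gs a) K.ν y := rfl
  have hbr := hK.sum_pd_q_mul_br hy a
  simp only [← hdiv, hg221, hν, c, nullShape, Fin.sum_univ_two, hK.u_symm hy 1 0, ν] at hbr ⊢
  linear_combination (1 / 4) * hbr

lemma rhsR_eq (hK : K.MetricOn W) (hy : y ∈ W) {z : Fin 2 → Sp 3 → ℝ}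
    (hz : ∀ a, ContDiffAt ℝ ∞ (z a) y) (a : Fin 2) :
    K.rhsR z a y = pd 0 (K.shiftRate z a) y + 2 * K.ν y * K.shiftRate z a y + K.c a y := by
  have hu := hK.contDiffAt_u hy
  have hq := hK.contDiffAt_q hy
  have hn := hK.contDiffAt_n hy
  unfold shiftRate
  simp (disch := fun_prop) only [rhsR, hK.χ₀_eq hy, pd_mul, pd_sub, pd_add, hK.pd_zero_n hy, ν,
    Fin.sum_univ_two]
  ring

end MetricOn

end Known

namespace Known

variable {𝔤 : Type*} [LieRing 𝔤] [LieAlgebra ℝ 𝔤] {N : ℕ}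

/-- The value `-2 g^{12} X_{,2} + 2 g^{12} g^{αλ} A_{α,2} z_λ - g^{αβ} A_{α,β}` on the hyperplane of
`g₁₂ F^{21} - (Δ + Γ^γ A_γ)`, the quantity transported along the null direction by the Yang-Mills
equation, for the unknowns `X = A₁` and `z = (g₁₃, g₁₄)`. -/
def gaugeRate (K : Known 𝔤) (ε : Module.Basis (Fin N) ℝ 𝔤) (X : Sp 3 → 𝔤)
    (z : Fin 2 → Sp 3 → ℝ) : Sp 3 → 𝔤 := fun y =>
  (-2 * K.n y) • pdL ε 0 X y + ∑ l, (2 * z l y) • K.w₂ ε l y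
    - ∑ a, ∑ b, K.u a b y • pdL ε (gs b) (K.A a) y

namespace MetricOn

variable {K : Known 𝔤} {W : Set (Sp 3)} {y : Sp 3} {ε : Module.Basis (Fin N) ℝ 𝔤}

lemma smoothAt_w (hK : K.MetricOn W) (hy : y ∈ W) (hA : ∀ a, SmoothAt ε (K.A a) y) (l : Fin 2) :
    SmoothAt ε (K.w l) y := by
  have hu := hK.contDiffAt_u hy
  have hn := hK.contDiffAt_n hy
  unfold w
  fun_prop

lemma smoothAt_w₂ (hK : K.MetricOn W) (hy : y ∈ W) (hA : ∀ a, SmoothAt ε (K.A a) y) (l : Fin 2) :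
    SmoothAt ε (K.w₂ ε l) y := by
  have hu := hK.contDiffAt_u hy
  have hn := hK.contDiffAt_n hy
  unfold w₂
  fun_prop

lemma kA_eq (hK : K.MetricOn W) (hy : y ∈ W) (hA : ∀ a, SmoothAt ε (K.A a) y) (l : Fin 2) :
    K.kA ε l y = (4 * K.ν y) • K.w₂ ε l y + (2 : ℝ) • pdL ε 0 (K.w₂ ε l) y := by
  have htr := hK.contDiffAt_tr2 hy
  have hw := hK.smoothAt_w hy hA l
  have hw₂ := hK.smoothAt_w₂ hy hA l
  simp (disch := fun_prop) only [kA, ν, pdL_add, pdL_smul, pd_mul, pd_const]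
  module

lemma g12_smul_pdL_n_smul (hK : K.MetricOn W) (hy : y ∈ W) {v : Sp 3 → 𝔤} (hv : SmoothAt ε v y)
    (i : Fin 3) : K.g12 y • pdL ε i (fun z => K.n z • v z) y
      = pdL ε i v y - (K.n y * pd i K.g12 y) • v y := by
  rw [pdL_smul i (hK.contDiffAt_n hy) hv, hK.pd_n hy]
  linear_combination (norm := module) (hK.n_mul_g12 hy) •
    (pdL ε i v y - (K.n y * pd i K.g12 y) • v y)

lemma w_eq (K : Known 𝔤) (l : Fin 2) :
    K.w l = fun y => K.n y • ∑ a, K.u a l y • K.A a y := by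
  funext y
  simp only [w, Finset.smul_sum, smul_smul]

lemma w₂_eq (K : Known 𝔤) (l : Fin 2) :
    K.w₂ ε l = fun y => K.n y • ∑ a, K.u a l y • pdL ε 0 (K.A a) y := by
  funext y
  simp only [w₂, Finset.smul_sum, smul_smul]

lemma g12_smul_div_w₂ (hK : K.MetricOn W) (hy : y ∈ W) (hA : ∀ a, SmoothAt ε (K.A a) y) :
    K.g12 y • ∑ l, (pdL ε (gs l) (K.w₂ ε l) y + K.logVolDeriv l y • K.w₂ ε l y)
      = ∑ a, ∑ l, (K.u a l y • pdL ε (gs l) (pdL ε 0 (K.A a)) y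
        + (pd (gs l) (K.u a l) y
          + (1 / 2) * K.u a l y * ∑ b, ∑ d, K.u b d y * pd (gs l) (K.q b d) y)
            • pdL ε 0 (K.A a) y) := by
  have hu := hK.contDiffAt_u hy
  have hterm : ∀ l, K.g12 y • (pdL ε (gs l) (K.w₂ ε l) y + K.logVolDeriv l y • K.w₂ ε l y)
      = ∑ a, (K.u a l y • pdL ε (gs l) (pdL ε 0 (K.A a)) y
        + (pd (gs l) (K.u a l) y
          + (1 / 2) * K.u a l y * ∑ b, ∑ d, K.u b d y * pd (gs l) (K.q b d) y)
            • pdL ε 0 (K.A a) y) := fun l => by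
    have hcancel : ∀ v : 𝔤, K.g12 y • K.logVolDeriv l y • K.n y • v = K.logVolDeriv l y • v := by
      intro v
      linear_combination (norm := module) (hK.n_mul_g12 hy) • (K.logVolDeriv l y • v)
    rw [w₂_eq, smul_add, hK.g12_smul_pdL_n_smul hy (by fun_prop), hcancel]
    simp (disch := fun_prop) only [pdL_add, pdL_smul, logVolDeriv, Fin.sum_univ_two]
    module
  simp only [Finset.smul_sum, hterm]
  exact Finset.sum_comm

lemma aG_eq (hK : K.MetricOn W) (hy : y ∈ W) (hA : ∀ a, SmoothAt ε (K.A a) y) :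
    K.aG ε y = -(∑ b, ∑ a, K.u b a y • ⁅K.A b y, pdL ε 0 (K.A a) y⁆)
      - ∑ a, ∑ b, ((1 / 2) * K.u a b y * ∑ l, ∑ m, K.u l m y * pd (gs b) (K.q l m) y
          + pd (gs b) (K.u a b) y) • pdL ε 0 (K.A a) y
      - (2 : ℝ) • ∑ a, ∑ b, K.u a b y • pdL ε (gs b) (pdL ε 0 (K.A a)) y
      - ∑ a, ∑ b, (2 * K.ν y * K.u a b y + pd 0 (K.u a b) y) • pdL ε (gs b) (K.A a) y := by
  have hw := hK.smoothAt_w hy hA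
  have ht := hK.contDiffAt_t hy
  have hg12 := hK.contDiffAt_g12 hy
  have hcomm : ∀ l, pd 0 (pd (gs l) K.g12) y = pd (gs l) K.g122 y := fun l => pd_comm _ _ hg12
  have hgrad : pdL ε 0 (fun z => ∑ l, (2 * pd (gs l) K.g12 z) • K.w l z
        - ∑ a, (∑ d, K.u a d z * K.t d z) • K.A a z) y
      = ∑ l, ((2 * pd (gs l) K.g122 y - pd 0 (fun z => K.g12 z * K.t l z) y) • K.w l y
        + (2 * pd (gs l) K.g12 y - K.g12 y * K.t l y) • pdL ε 0 (K.w l) y) := by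
    have hw_t : Set.EqOn (fun z => ∑ l, (2 * pd (gs l) K.g12 z) • K.w l z
        - ∑ a, (∑ d, K.u a d z * K.t d z) • K.A a z)
        (fun z => ∑ l, (2 * pd (gs l) K.g12 z - K.g12 z * K.t l z) • K.w l z) W := fun z hz => by
      simp only [w_eq]
      linear_combination (norm := (simp only [Fin.sum_univ_two]; module)) (hK.n_mul_g12 hz) •
        (∑ a, (∑ d, K.u a d z * K.t d z) • K.A a z)
    rw [pdL_congr_of_eqOn 0 (hK.isOpen.mem_nhds hy) hw_t]
    simp (disch := fun_prop) only [pdL_sum, pdL_smul, pd_sub, pd_mul, pd_const, hcomm, zero_mul,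
      zero_add]
  rw [aG, hgrad]
  simp only [ν, Fin.sum_univ_two, hK.u_symm hy 1 0, hK.pd_q_symm hy _ 1 0]
  module

lemma rhsA_eq (hK : K.MetricOn W) (hy : y ∈ W) (hA : ∀ a, SmoothAt ε (K.A a) y) {X : Sp 3 → 𝔤}
    {z : Fin 2 → Sp 3 → ℝ} (hX : SmoothAt ε X y) (hz : ∀ a, ContDiffAt ℝ ∞ (z a) y) :
    K.rhsA ε X z y = pdL ε 0 (K.gaugeRate ε X z) y + (2 * K.ν y) • K.gaugeRate ε X z y
      - K.g12 y • ∑ l, (pdL ε (gs l) (K.w₂ ε l) y + K.logVolDeriv l y • K.w₂ ε l y)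
      - ∑ a, ∑ b, K.u a b y • ⁅K.A a y, pdL ε 0 (K.A b) y⁆ := by
  have hu := hK.contDiffAt_u hy
  have hn := hK.contDiffAt_n hy
  have hw₂ := hK.smoothAt_w₂ hy hA
  have hcomm : ∀ a i, pdL ε 0 (pdL ε i (K.A a)) y = pdL ε i (pdL ε 0 (K.A a)) y :=
    fun a i => pdL_comm _ _ (hA a)
  rw [hK.g12_smul_div_w₂ hy hA]
  unfold gaugeRate
  simp (disch := fun_prop) only [rhsA, hK.kA_eq hy hA, hK.aG_eq hy hA, pdL_add, pdL_sub, pdL_smul,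
    pd_mul, pd_const, hK.pd_zero_n hy, hcomm, ν, Fin.sum_univ_two]
  module

end MetricOn

end Known

/-! ### Null data -/

lemma sum_fin_four {M : Type*} [AddCommMonoid M] (h : Fin 4 → M) :
    ∑ k, h k = h 0 + h 1 + ∑ a : Fin 2, h (gk a) := by
  rw [Fin.sum_univ_succ, Fin.sum_univ_succ, add_assoc]
  rfl

lemma det_of_null_row {R : Type*} [CommRing R] {M : Matrix (Fin 4) (Fin 4) R} (h11 : M 1 1 = 0)
    (h1a : ∀ a, M 1 (gk a) = 0) (ha1 : ∀ a, M (gk a) 1 = 0) :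
    M.det = -(M 0 1 * M 1 0) * (Matrix.of fun a b => M (gk a) (gk b)).det := by
  have h12 : M 1 2 = 0 := h1a 0
  have h13 : M 1 3 = 0 := h1a 1
  have h21 : M 2 1 = 0 := ha1 0
  have h31 : M 3 1 = 0 := ha1 1
  have hdet : (Matrix.of fun a b : Fin 2 => M (gk a) (gk b)).det = M 2 2 * M 3 3 - M 2 3 * M 3 2 :=
    Matrix.det_fin_two _
  rw [hdet, Matrix.det_succ_row _ 1, Fin.sum_univ_four, h11, h12, h13, Matrix.det_fin_three]
  simp only [Matrix.submatrix_apply, Fin.succAbove, Fin.succAbove_zero, Fin.lt_def, Fin.reduceSucc,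
    Fin.reduceCastSucc, Fin.coe_ofNat_eq_mod, Nat.reduceMod, zero_lt_one, lt_self_iff_false,
    Nat.not_ofNat_lt_one, ↓reduceIte, h21, h31]
  ring

namespace Fields

variable {𝔤 : Type*}

/-- Twice the Christoffel symbols of the first kind, `g_{mj,i} + g_{mi,j} - g_{ij,m}`. -/
def low (F : Fields 𝔤) (m i j : Fin 4) : Sp 4 → ℝ := fun x =>
  pd i (F.g m j) x + pd j (F.g m i) x - pd m (F.g i j) x

/-- The part of the hyperplane over `U` where `g₁₂` and `(g_{αβ})` are nondegenerate. -/
def dom (F : Fields 𝔤) (U : Set (Sp 4)) : Set (Sp 3) :=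
  {y | emb y ∈ U ∧ F.known.g12 y ≠ 0 ∧ (Matrix.of fun a b => F.known.q a b y).det ≠ 0}

/-- The value `g_{2α,1}` on the hyperplane, the only first derivative of the metric in a direction
transversal to the hyperplane that enters the `2α` components of the equations and is not known. -/
def g2a1 (F : Fields 𝔤) (a : Fin 2) : Sp 3 → ℝ := fun y => pd 0 (F.g 1 (gk a)) (emb y)

variable [LieRing 𝔤] [LieAlgebra ℝ 𝔤] {N : ℕ} {F : Fields 𝔤} {ε : Module.Basis (Fin N) ℝ 𝔤}

namespace RegularOn

variable {U : Set (Sp 4)} {x : Sp 4}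

lemma contDiffAt_g (hF : F.RegularOn ε U) (hU : U ∈ 𝓝 x) (i j : Fin 4) :
    ContDiffAt ℝ ∞ (F.g i j) x :=
  (hF.smooth_g i j).contDiffAt hU

lemma smoothAt_A (hF : F.RegularOn ε U) (hU : U ∈ 𝓝 x) (i : Fin 4) : SmoothAt ε (F.A i) x :=
  fun I => (hF.smooth_A i I).contDiffAt hU

lemma smoothAt_Φ (hF : F.RegularOn ε U) (hU : U ∈ 𝓝 x) : SmoothAt ε F.Φ x :=
  fun I => (hF.smooth_Φ I).contDiffAt hU

lemma contDiffAt_gInv (hF : F.RegularOn ε U) (hU : U ∈ 𝓝 x) (i j : Fin 4) :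
    ContDiffAt ℝ ∞ (F.gInv i j) x :=
  contDiffAt_matrix_inv (hF.contDiffAt_g hU) (hF.nondeg x (mem_of_mem_nhds hU)) i j

lemma contDiffAt_chr (hF : F.RegularOn ε U) (hU : U ∈ 𝓝 x) (k i j : Fin 4) :
    ContDiffAt ℝ ∞ (F.chr k i j) x := by
  have hg := hF.contDiffAt_g hU
  have hgInv := hF.contDiffAt_gInv hU
  unfold chr
  fun_prop

lemma contDiffAt_Γ (hF : F.RegularOn ε U) (hU : U ∈ 𝓝 x) (k : Fin 4) :
    ContDiffAt ℝ ∞ (F.Γ k) x := by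
  have hgInv := hF.contDiffAt_gInv hU
  have hchr := hF.contDiffAt_chr hU
  unfold Γ
  fun_prop

lemma gInv_symm (hF : F.RegularOn ε U) (hx : x ∈ U) (i j : Fin 4) : F.gInv i j x = F.gInv j i x :=
  (Matrix.IsSymm.ext fun k l => hF.symm l k x hx).inv.apply j i

lemma sum_g_mul_gInv (hF : F.RegularOn ε U) (hx : x ∈ U) (i k : Fin 4) :
    ∑ j, F.g i j x * F.gInv j k x = if i = k then 1 else 0 :=
  sum_mul_inv_apply (hF.nondeg x hx).isUnit i k

lemma pd_g_symm (hF : F.RegularOn ε U) (hU : U ∈ 𝓝 x) (k i j : Fin 4) :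
    pd k (F.g i j) x = pd k (F.g j i) x :=
  pd_congr_of_eqOn k hU (hF.symm i j)

lemma chr_symm (hF : F.RegularOn ε U) (hU : U ∈ 𝓝 x) (k i j : Fin 4) :
    F.chr k i j x = F.chr k j i x := by
  simp only [chr, hF.pd_g_symm hU _ i j, add_comm (pd i _ x)]

lemma sum_g_mul_chr (hF : F.RegularOn ε U) (hx : x ∈ U) (m i j : Fin 4) :
    ∑ k, F.g m k x * F.chr k i j x = (1 / 2) * F.low m i j x := by
  rw [← sum_mul_sum_eq_of_inverse (hF.sum_g_mul_gInv hx) (fun l => F.low l i j x) m, Finset.mul_sum]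
  exact Finset.sum_congr rfl fun k _ => mul_left_comm _ _ _

end RegularOn

/-- Data on a set `S` of the hyperplane which makes it null with `x²` along its generators and
`A₂ = 0`, and with the gauge conditions `g_{12,2} = ¼ g₁₂ g^{αβ} g_{αβ,2}` and
`g_{22,1} = 2 g_{12,2}` for the parametrization of the generators; no conformal decomposition of
`(g_{αβ})` is chosen. -/
structure NullData (F : Fields 𝔤) (ε : Module.Basis (Fin N) ℝ 𝔤) (U : Set (Sp 4))
    (S : Set (Sp 3)) : Prop where
  isOpen : IsOpen U
  regular : F.RegularOn ε U
  emb_mem : ∀ y ∈ S, emb y ∈ U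
  subset_closure_interior : S ⊆ closure (interior S)
  g22 : ∀ y ∈ S, F.g 1 1 (emb y) = 0
  g2a : ∀ a, ∀ y ∈ S, F.g 1 (gk a) (emb y) = 0
  A2 : ∀ y ∈ S, F.A 1 (emb y) = 0
  g122 : ∀ y ∈ S, pd 1 (F.g 0 1) (emb y) = (1 / 4) * F.g 0 1 (emb y) * F.known.tr2 y
  g221 : ∀ y ∈ S, pd 0 (F.g 1 1) (emb y) = 2 * pd 1 (F.g 0 1) (emb y)

namespace NullData

variable {U : Set (Sp 4)} {S : Set (Sp 3)} {y : Sp 3}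

lemma mem_nhds (D : F.NullData ε U S) (hy : y ∈ S) : U ∈ 𝓝 (emb y) :=
  D.isOpen.mem_nhds (D.emb_mem y hy)

lemma contDiffAt_g_comp_emb (D : F.NullData ε U S) (hy : emb y ∈ U) (i j : Fin 4) :
    ContDiffAt ℝ ∞ (fun z => F.g i j (emb z)) y :=
  contDiffAt_comp_emb (D.regular.contDiffAt_g (D.isOpen.mem_nhds hy) i j)

lemma metricOn (D : F.NullData ε U S) : F.known.MetricOn (F.dom U) where
  isOpen := by
    refine isOpen_iff_mem_nhds.2 fun y hy => ?_
    have hU : ∀ᶠ z in 𝓝 y, emb z ∈ U :=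
      contDiff_emb.continuous.continuousAt.eventually_mem (D.isOpen.mem_nhds hy.1)
    have hg12 := (D.contDiffAt_g_comp_emb hy.1 0 1).continuousAt.eventually_ne hy.2.1
    have hdet := (contDiffAt_det fun a b =>
      D.contDiffAt_g_comp_emb hy.1 (gk a) (gk b)).continuousAt.eventually_ne hy.2.2
    filter_upwards [hU, hg12, hdet] with z hzU hz12 hzdet using ⟨hzU, hz12, hzdet⟩
  smooth_g12 := fun _ hy => (D.contDiffAt_g_comp_emb hy.1 0 1).contDiffWithinAt
  smooth_q := fun a b _ hy => (D.contDiffAt_g_comp_emb hy.1 (gk a) (gk b)).contDiffWithinAt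
  g12_ne := fun _ hy => hy.2.1
  det_q_ne := fun _ hy => hy.2.2
  symm_q := fun a b y hy => D.regular.symm (gk a) (gk b) (emb y) hy.1

lemma symm (D : F.NullData ε U S) (hy : y ∈ S) (i j : Fin 4) :
    F.g i j (emb y) = F.g j i (emb y) :=
  D.regular.symm i j (emb y) (D.emb_mem y hy)

lemma subset_dom (D : F.NullData ε U S) : S ⊆ F.dom U := fun y hy => by
  have hdet := D.regular.nondeg _ (D.emb_mem y hy)
  rw [det_of_null_row (D.g22 y hy) (D.g2a · y hy)
    (fun a => (D.symm hy (gk a) 1).trans (D.g2a a y hy))] at hdet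
  have hprod := mul_ne_zero_iff.1 hdet
  exact ⟨D.emb_mem y hy, (mul_ne_zero_iff.1 (neg_ne_zero.1 hprod.1)).1, hprod.2⟩

lemma pd_succ (D : F.NullData ε U S) (hy : y ∈ S) {f : Sp 4 → ℝ} {g : Sp 3 → ℝ}
    (h : ∀ z ∈ S, f (emb z) = g z) (hf : ContDiffAt ℝ ∞ f (emb y)) (hg : ContDiffAt ℝ ∞ g y)
    (i : Fin 3) : pd i.succ f (emb y) = pd i g y := by
  rw [← pd_comp_emb i (differentiableAt_of_contDiffAt hf)]
  exact pd_eq_of_eqOn i (D.subset_closure_interior hy) h (contDiffAt_comp_emb hf) hg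

lemma pdL_succ (D : F.NullData ε U S) (hy : y ∈ S) {f : Sp 4 → 𝔤} {g : Sp 3 → 𝔤}
    (h : ∀ z ∈ S, f (emb z) = g z) (hf : SmoothAt ε f (emb y)) (hg : SmoothAt ε g y)
    (i : Fin 3) : pdL ε i.succ f (emb y) = pdL ε i g y := by
  rw [← pdL_comp_emb i hf]
  exact pdL_eq_of_eqOn i (D.subset_closure_interior hy) h hf.comp_emb hg

lemma gInv_zero (D : F.NullData ε U S) (hy : y ∈ S) (k : Fin 4) :
    F.gInv 0 k (emb y) = if k = 1 then F.known.n y else 0 := by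
  have hrow := D.regular.sum_g_mul_gInv (D.emb_mem y hy) 1 k
  have hn := D.metricOn.n_mul_g12 (D.subset_dom hy)
  simp only [sum_fin_four, D.g22 y hy, D.g2a _ y hy, zero_mul, Finset.sum_const_zero, add_zero,
    eq_comm (a := (1 : Fin 4)), D.symm hy 1 0] at hrow
  rw [← mul_one (F.known.n y), ← mul_ite_zero, ← hrow, ← mul_assoc]
  exact (one_mul _).symm.trans (congrArg (· * _) hn.symm)

lemma gInv_gk (D : F.NullData ε U S) (hy : y ∈ S) (b : Fin 2) (k : Fin 4) :
    F.gInv (gk b) k (emb y) = ∑ a, F.known.u b a y *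
      ((if gk a = k then 1 else 0) - F.unkG a y * F.gInv 0 k (emb y)) := by
  have hrow : ∀ a, (if gk a = k then 1 else 0) - F.unkG a y * F.gInv 0 k (emb y)
      = ∑ c, F.known.q a c y * F.gInv (gk c) k (emb y) := fun a => by
    rw [← D.regular.sum_g_mul_gInv (D.emb_mem y hy) (gk a) k, sum_fin_four, D.symm hy (gk a) 0,
      D.symm hy (gk a) 1, D.g2a a y hy, unkG]
    simp only [known]
    ring
  simp only [hrow]
  exact (sum_mul_sum_eq_of_inverse (D.metricOn.sum_u_mul_q (D.subset_dom hy))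
    (fun c => F.gInv (gk c) k (emb y)) b).symm

lemma gInv_zero_zero (D : F.NullData ε U S) (hy : y ∈ S) : F.gInv 0 0 (emb y) = 0 :=
  D.gInv_zero hy 0

lemma gInv_zero_one (D : F.NullData ε U S) (hy : y ∈ S) : F.gInv 0 1 (emb y) = F.known.n y :=
  D.gInv_zero hy 1

lemma gInv_one_zero (D : F.NullData ε U S) (hy : y ∈ S) : F.gInv 1 0 (emb y) = F.known.n y := by
  rw [D.regular.gInv_symm (D.emb_mem y hy), D.gInv_zero_one hy]

lemma gInv_zero_gk (D : F.NullData ε U S) (hy : y ∈ S) (a : Fin 2) :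
    F.gInv 0 (gk a) (emb y) = 0 := by
  rw [D.gInv_zero hy, if_neg (by fin_cases a <;> decide)]

lemma gInv_gk_zero (D : F.NullData ε U S) (hy : y ∈ S) (a : Fin 2) :
    F.gInv (gk a) 0 (emb y) = 0 := by
  rw [D.regular.gInv_symm (D.emb_mem y hy), D.gInv_zero_gk hy]

lemma gInv_gk_one (D : F.NullData ε U S) (hy : y ∈ S) (a : Fin 2) :
    F.gInv (gk a) 1 (emb y) = -F.known.n y * ∑ b, F.known.u a b y * F.unkG b y := by
  rw [D.gInv_gk hy, D.gInv_zero_one hy, Finset.mul_sum]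
  exact Finset.sum_congr rfl fun b _ => by
    rw [if_neg (by fin_cases b <;> decide)]
    ring

lemma gInv_one_gk (D : F.NullData ε U S) (hy : y ∈ S) (a : Fin 2) :
    F.gInv 1 (gk a) (emb y) = -F.known.n y * ∑ b, F.known.u a b y * F.unkG b y := by
  rw [D.regular.gInv_symm (D.emb_mem y hy), D.gInv_gk_one hy]

lemma gInv_gk_gk (D : F.NullData ε U S) (hy : y ∈ S) (a b : Fin 2) :
    F.gInv (gk a) (gk b) (emb y) = F.known.u a b y := by
  simp [D.gInv_gk hy, D.gInv_zero_gk hy]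


lemma pd_succ_g (D : F.NullData ε U S) (hy : y ∈ S) (i : Fin 3) (j k : Fin 4) :
    pd i.succ (F.g j k) (emb y) = pd i (fun z => F.g j k (emb z)) y :=
  (pd_comp_emb i (differentiableAt_of_contDiffAt (D.regular.contDiffAt_g (D.mem_nhds hy) j k))).symm

lemma four_mul_ν (D : F.NullData ε U S) (hy : y ∈ S) : 4 * F.known.ν y = F.known.tr2 y := by
  have hn := D.metricOn.n_mul_g12 (D.subset_dom hy)
  have hg122 : F.known.g122 y = (1 / 4) * F.known.g12 y * F.known.tr2 y :=
    (D.pd_succ_g hy 0 0 1).symm.trans (D.g122 y hy)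
  rw [Known.ν, hg122]
  linear_combination F.known.tr2 y * hn

lemma pd_succ_g22 (D : F.NullData ε U S) (hy : y ∈ S) (i : Fin 3) :
    pd i.succ (F.g 1 1) (emb y) = 0 :=
  (D.pd_succ hy D.g22 (D.regular.contDiffAt_g (D.mem_nhds hy) 1 1) contDiffAt_const i).trans
    (pd_const i 0 y)

lemma pd_succ_g2a (D : F.NullData ε U S) (hy : y ∈ S) (i : Fin 3) (a : Fin 2) :
    pd i.succ (F.g 1 (gk a)) (emb y) = 0 :=
  (D.pd_succ hy (D.g2a a) (D.regular.contDiffAt_g (D.mem_nhds hy) 1 (gk a)) contDiffAt_const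
    i).trans (pd_const i 0 y)

lemma pd_zero_g22 (D : F.NullData ε U S) (hy : y ∈ S) :
    pd 0 (F.g 1 1) (emb y) = 2 * F.known.g122 y :=
  (D.g221 y hy).trans (congrArg (2 * ·) (D.pd_succ_g hy 0 0 1))

lemma pd_g_symm (D : F.NullData ε U S) (hy : y ∈ S) (k i j : Fin 4) :
    pd k (F.g i j) (emb y) = pd k (F.g j i) (emb y) :=
  D.regular.pd_g_symm (D.mem_nhds hy) k i j

lemma low_one_one_gk (D : F.NullData ε U S) (hy : y ∈ S) (a : Fin 2) :
    F.low 1 1 (gk a) (emb y) = 0 := by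
  rw [low, D.pd_succ_g22 hy (gs a), add_sub_cancel_left]

lemma low_zero_one_gk (D : F.NullData ε U S) (hy : y ∈ S) (a : Fin 2) :
    F.low 0 1 (gk a) (emb y)
      = pd 0 (F.unkG a) y + pd (gs a) F.known.g12 y - F.g2a1 a y := by
  rw [low, D.pd_succ_g hy (gs a) 0 1]
  exact congrArg (· + _ - _) (D.pd_succ_g hy 0 0 (gk a))

lemma low_gk_one_gk (D : F.NullData ε U S) (hy : y ∈ S) (a c : Fin 2) :
    F.low (gk c) 1 (gk a) (emb y) = pd 0 (F.known.q a c) y := by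
  rw [low, D.pd_g_symm hy _ (gk c) 1, D.pd_succ_g2a hy (gs a), D.pd_succ_g2a hy (gs c), add_zero,
    sub_zero, D.pd_g_symm hy]
  exact D.pd_succ_g hy 0 (gk a) (gk c)

lemma low_one_one_zero (D : F.NullData ε U S) (hy : y ∈ S) :
    F.low 1 1 0 (emb y) = 2 * F.known.g122 y := by
  rw [low, D.pd_zero_g22 hy, add_sub_cancel_left]

lemma low_gk_one_zero (D : F.NullData ε U S) (hy : y ∈ S) (a : Fin 2) :
    F.low (gk a) 1 0 (emb y) = pd 0 (F.unkG a) y + F.g2a1 a y - pd (gs a) F.known.g12 y := by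
  rw [low, D.pd_g_symm hy _ (gk a) 0, D.pd_g_symm hy _ (gk a) 1, D.pd_g_symm hy _ 1 0,
    D.pd_succ_g hy (gs a) 0 1]
  exact congrArg (· + _ - _) (D.pd_succ_g hy 0 0 (gk a))

lemma low_one_gk_zero (D : F.NullData ε U S) (hy : y ∈ S) (a : Fin 2) :
    F.low 1 (gk a) 0 (emb y) = pd (gs a) F.known.g12 y + F.g2a1 a y - pd 0 (F.unkG a) y := by
  rw [low, D.pd_g_symm hy _ (gk a) 0, D.pd_g_symm hy _ 1 0, D.pd_succ_g hy (gs a) 0 1]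
  exact congrArg (_ + _ - ·) (D.pd_succ_g hy 0 0 (gk a))

lemma low_one_gk_gk (D : F.NullData ε U S) (hy : y ∈ S) (a b : Fin 2) :
    F.low 1 (gk a) (gk b) (emb y) = -pd 0 (F.known.q a b) y := by
  rw [low, D.pd_succ_g2a hy (gs a), D.pd_succ_g2a hy (gs b), add_zero, zero_sub]
  exact congrArg (-·) (D.pd_succ_g hy 0 (gk a) (gk b))

lemma low_gk_gk_gk (D : F.NullData ε U S) (hy : y ∈ S) (a b c : Fin 2) :
    F.low (gk c) (gk a) (gk b) (emb y) = pd (gs a) (F.known.q c b) y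
      + pd (gs b) (F.known.q c a) y - pd (gs c) (F.known.q a b) y := by
  rw [low, D.pd_succ_g hy (gs a) (gk c), D.pd_succ_g hy (gs b) (gk c),
    D.pd_succ_g hy (gs c) (gk a)]
  rfl

lemma low_one_one (D : F.NullData ε U S) (hy : y ∈ S) (m : Fin 4) : F.low m 1 1 (emb y) = 0 := by
  refine Fin.cases ?_ (fun m => Fin.cases ?_ (fun a => ?_) m) m
  · rw [low, D.g221 y hy]
    ring
  · rw [Fin.succ_zero_eq_one, low, add_sub_assoc, sub_self, add_zero]
    exact D.pd_succ_g22 hy 0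
  · rw [low, D.pd_g_symm hy _ _ 1, D.pd_succ_g22 hy (gs a), sub_zero]
    exact (congrArg₂ (· + ·) (D.pd_succ_g2a hy 0 a) (D.pd_succ_g2a hy 0 a)).trans (add_zero 0)

lemma chr_one_one (D : F.NullData ε U S) (hy : y ∈ S) (k : Fin 4) : F.chr k 1 1 (emb y) = 0 := by
  have hlow : ∀ m, pd 1 (F.g m 1) (emb y) + pd 1 (F.g m 1) (emb y) - pd m (F.g 1 1) (emb y) = 0 :=
    D.low_one_one hy
  simp [chr, hlow]

lemma chr_zero (D : F.NullData ε U S) (hy : y ∈ S) (i j : Fin 4) :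
    F.chr 0 i j (emb y) = (1 / 2) * F.known.n y * F.low 1 i j (emb y) := by
  simp only [chr, D.gInv_zero hy, ite_mul, zero_mul, Finset.sum_ite_eq', Finset.mem_univ, if_true]
  exact (mul_assoc _ _ _).symm

lemma chr_gk (D : F.NullData ε U S) (hy : y ∈ S) (b : Fin 2) (i j : Fin 4) :
    F.chr (gk b) i j (emb y) = (1 / 2) * ∑ c, F.known.u b c y *
      (F.low (gk c) i j (emb y) - F.known.n y * F.unkG c y * F.low 1 i j (emb y)) := by
  simp only [chr, sum_fin_four, D.gInv_gk_zero hy, D.gInv_gk_one hy, D.gInv_gk_gk hy, low,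
    Fin.sum_univ_two]
  ring

lemma chr_zero_one_gk (D : F.NullData ε U S) (hy : y ∈ S) (a : Fin 2) :
    F.chr 0 1 (gk a) (emb y) = 0 := by
  rw [D.chr_zero hy, D.low_one_one_gk hy, mul_zero]

lemma chr_zero_one_zero (D : F.NullData ε U S) (hy : y ∈ S) :
    F.chr 0 1 0 (emb y) = F.known.ν y := by
  rw [D.chr_zero hy, D.low_one_one_zero hy, Known.ν]
  ring

lemma chr_zero_gk_zero (D : F.NullData ε U S) (hy : y ∈ S) (a : Fin 2) :
    F.chr 0 (gk a) 0 (emb y)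
      = (1 / 2) * F.known.n y * (pd (gs a) F.known.g12 y + F.g2a1 a y - pd 0 (F.unkG a) y) := by
  rw [D.chr_zero hy, D.low_one_gk_zero hy]

lemma chr_zero_gk_gk (D : F.NullData ε U S) (hy : y ∈ S) (a b : Fin 2) :
    F.chr 0 (gk a) (gk b) (emb y) = -(1 / 2) * F.known.n y * pd 0 (F.known.q a b) y := by
  rw [D.chr_zero hy, D.low_one_gk_gk hy]
  ring

lemma chr_gk_one_gk (D : F.NullData ε U S) (hy : y ∈ S) (b a : Fin 2) :
    F.chr (gk b) 1 (gk a) (emb y) = F.known.nullShape b a y := by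
  simp only [D.chr_gk hy, D.low_gk_one_gk hy, D.low_one_one_gk hy, mul_zero, sub_zero,
    Known.nullShape]

lemma chr_gk_one_zero (D : F.NullData ε U S) (hy : y ∈ S) (b : Fin 2) :
    F.chr (gk b) 1 0 (emb y) = (1 / 2) * ∑ c, F.known.u b c y *
      (pd 0 (F.unkG c) y + F.g2a1 c y - pd (gs c) F.known.g12 y
        - 2 * F.known.ν y * F.unkG c y) := by
  simp only [D.chr_gk hy, D.low_gk_one_zero hy, D.low_one_one_zero hy, Known.ν, Fin.sum_univ_two]
  ring

lemma chr_gk_gk_gk (D : F.NullData ε U S) (hy : y ∈ S) (d a b : Fin 2) :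
    F.chr (gk d) (gk a) (gk b) (emb y) = (1 / 2) * ∑ c, F.known.u d c y *
      (pd (gs a) (F.known.q c b) y + pd (gs b) (F.known.q c a) y - pd (gs c) (F.known.q a b) y
        + F.known.n y * F.unkG c y * pd 0 (F.known.q a b) y) := by
  simp only [D.chr_gk hy, D.low_gk_gk_gk hy, D.low_one_gk_gk hy, Fin.sum_univ_two]
  ring

lemma chr_one_one_gk (D : F.NullData ε U S) (hy : y ∈ S) (a : Fin 2) :
    F.chr 1 1 (gk a) (emb y) = (1 / 2) * F.known.n y *
      (pd 0 (F.unkG a) y + pd (gs a) F.known.g12 y - F.g2a1 a y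
        - ∑ b, ∑ l, pd 0 (F.known.q a b) y * F.known.u b l y * F.unkG l y) := by
  have hsum : ∑ m, F.gInv 1 m (emb y) * F.low m 1 (gk a) (emb y) = F.known.n y *
      (pd 0 (F.unkG a) y + pd (gs a) F.known.g12 y - F.g2a1 a y
        - ∑ b, ∑ l, pd 0 (F.known.q a b) y * F.known.u b l y * F.unkG l y) := by
    simp only [sum_fin_four, D.gInv_one_zero hy, D.gInv_one_gk hy, D.low_zero_one_gk hy,
      D.low_one_one_gk hy, D.low_gk_one_gk hy, Fin.sum_univ_two]
    ring
  rw [mul_assoc, ← hsum]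
  rfl

end NullData

end Fields

/-! ### The Ricci components -/

namespace Fields

variable {𝔤 : Type*}

/-- `g_{αβ} Γ^β` along the hyperplane `x¹ = 0`. -/
def loweredΓ (F : Fields 𝔤) (a : Fin 2) : Sp 3 → ℝ := fun y =>
  ∑ b, F.known.q a b y * F.Γ (gk b) (emb y)

namespace NullData

variable [LieRing 𝔤] [LieAlgebra ℝ 𝔤] {N : ℕ} {F : Fields 𝔤}
  {ε : Module.Basis (Fin N) ℝ 𝔤} {U : Set (Sp 4)} {S : Set (Sp 3)} {y : Sp 3}

lemma contDiffAt_unkG (D : F.NullData ε U S) (hy : y ∈ S) (a : Fin 2) :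
    ContDiffAt ℝ ∞ (F.unkG a) y :=
  contDiffAt_comp_emb (D.regular.contDiffAt_g (D.mem_nhds hy) 0 (gk a))

lemma contDiffAt_chr_comp_emb (D : F.NullData ε U S) (hy : y ∈ S) (k i j : Fin 4) :
    ContDiffAt ℝ ∞ (fun z => F.chr k i j (emb z)) y :=
  contDiffAt_comp_emb (D.regular.contDiffAt_chr (D.mem_nhds hy) k i j)

lemma contDiffAt_loweredΓ (D : F.NullData ε U S) (hy : y ∈ S) (a : Fin 2) :
    ContDiffAt ℝ ∞ (F.loweredΓ a) y := by
  have hq := D.metricOn.contDiffAt_q (D.subset_dom hy)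
  have hΓ := fun b => contDiffAt_comp_emb (D.regular.contDiffAt_Γ (D.mem_nhds hy) (gk b))
  unfold loweredΓ
  fun_prop

lemma sum_nullShape (D : F.NullData ε U S) (hy : y ∈ S) :
    ∑ b, F.known.nullShape b b y = 2 * F.known.ν y := by
  have htr := D.four_mul_ν hy
  simp only [Known.tr2, Known.nullShape, Fin.sum_univ_two,
    D.metricOn.pd_q_symm (D.subset_dom hy) 0 1 0] at htr ⊢
  linear_combination -(1 / 2) * htr

lemma Γ_zero (D : F.NullData ε U S) (hy : y ∈ S) : F.Γ 0 (emb y) = 0 := by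
  have htr := D.four_mul_ν hy
  have hchr := D.regular.chr_symm (D.mem_nhds hy) 0
  simp only [Known.tr2, Fin.sum_univ_two, D.metricOn.pd_q_symm (D.subset_dom hy) 0 1 0] at htr
  simp only [Γ, sum_fin_four, D.gInv_zero_zero hy, D.gInv_zero_one hy, D.gInv_zero_gk hy,
    D.gInv_one_zero hy, D.gInv_gk_zero hy, D.gInv_gk_gk hy, D.chr_one_one hy, hchr 0 1,
    hchr (gk _) 1, D.chr_zero_one_gk hy, D.chr_zero_one_zero hy, D.chr_zero_gk_gk hy,
    Fin.sum_univ_two, D.metricOn.pd_q_symm (D.subset_dom hy) 0 1 0]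
  linear_combination (1 / 2) * F.known.n y * htr

lemma Γ_gk (D : F.NullData ε U S) (hy : y ∈ S) (b : Fin 2) :
    F.Γ (gk b) (emb y) = ∑ c, F.known.u b c y * (F.known.n y *
      (pd 0 (F.unkG c) y + F.g2a1 c y - pd (gs c) F.known.g12 y
        - ∑ d, ∑ l, pd 0 (F.known.q c d) y * F.known.u d l y * F.unkG l y)
      + (1 / 2) * F.known.s c y) := by
  have hdom := D.subset_dom hy
  have htr := D.four_mul_ν hy
  have hchr := D.regular.chr_symm (D.mem_nhds hy) (gk b)
  simp only [Γ, sum_fin_four, D.gInv_zero_zero hy, D.gInv_zero_one hy, D.gInv_zero_gk hy,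
    D.gInv_one_zero hy, D.gInv_gk_zero hy, D.gInv_gk_one hy, D.gInv_one_gk hy, D.gInv_gk_gk hy,
    D.chr_one_one hy, hchr 0 1, hchr (gk _) 1, D.chr_gk_one_gk hy, D.chr_gk_one_zero hy,
    D.chr_gk_gk_gk hy, Known.s, Known.nullShape, Fin.sum_univ_two]
  simp only [Known.tr2, Fin.sum_univ_two] at htr
  simp only [D.metricOn.u_symm hdom 1 0, D.metricOn.pd_q_symm hdom _ 1 0] at htr ⊢
  linear_combination -(1 / 2) * F.known.n y *
    (F.known.u b 0 y * F.unkG 0 y + F.known.u b 1 y * F.unkG 1 y) * htr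

lemma loweredΓ_eq (D : F.NullData ε U S) (hy : y ∈ S) (a : Fin 2) :
    F.loweredΓ a y = F.known.n y *
      (pd 0 (F.unkG a) y + F.g2a1 a y - pd (gs a) F.known.g12 y
        - ∑ d, ∑ l, pd 0 (F.known.q a d) y * F.known.u d l y * F.unkG l y)
      + (1 / 2) * F.known.s a y := by
  simp only [loweredΓ, D.Γ_gk hy]
  exact sum_mul_sum_eq_of_inverse (D.metricOn.sum_q_mul_u (D.subset_dom hy)) _ a

/-- The transversal derivative `g_{2α,1}` cancels. -/
lemma chr_add_half_loweredΓ (D : F.NullData ε U S) (hy : y ∈ S) (a : Fin 2) :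
    F.chr 1 1 (gk a) (emb y) + (1 / 2) * F.loweredΓ a y
      = F.known.shiftRate F.unkG a y + (1 / 4) * F.known.s a y := by
  rw [D.chr_one_one_gk hy, D.loweredΓ_eq hy, Known.shiftRate]
  ring

lemma pd_zero_loweredΓ (D : F.NullData ε U S) (hy : y ∈ S) (a : Fin 2) :
    pd 0 (F.loweredΓ a) y = ∑ b, (pd 0 (F.known.q a b) y * F.Γ (gk b) (emb y)
      + F.known.q a b y * pd 1 (F.Γ (gk b)) (emb y)) := by
  have hq := fun b =>
    differentiableAt_of_contDiffAt (D.metricOn.contDiffAt_q (D.subset_dom hy) a b)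
  have hΓ := fun b => D.regular.contDiffAt_Γ (D.mem_nhds hy) (gk b)
  have hΓS := fun b => differentiableAt_of_contDiffAt (contDiffAt_comp_emb (hΓ b))
  refine (pd_sum 0 fun b => (hq b).mul (hΓS b)).trans (Finset.sum_congr rfl fun b _ => ?_)
  refine (pd_mul 0 (hq b) (hΓS b)).trans ?_
  rw [pd_comp_emb 0 (differentiableAt_of_contDiffAt (hΓ b))]
  rfl

lemma combR_eq_ricci_add (D : F.NullData ε U S) (hy : y ∈ S) (a : Fin 2) :
    F.combR a (emb y) = F.ricci 1 (gk a) (emb y) + (1 / 2) * pd 0 (F.loweredΓ a) y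
      + F.known.ν y * F.loweredΓ a y := by
  have hpdq : ∀ b, pd 1 (F.g (gk a) (gk b)) (emb y) = pd 0 (F.known.q a b) y := fun b =>
    D.pd_succ_g hy 0 (gk a) (gk b)
  have hg12 : pd 1 (F.g 0 1) (emb y) = F.known.g122 y := D.pd_succ_g hy 0 0 1
  have hgq : ∀ b, F.g (gk a) (gk b) (emb y) = F.known.q a b y := fun b => rfl
  simp only [combR, D.gInv_zero_one hy, hg12, hpdq, hgq, D.pd_zero_loweredΓ hy, loweredΓ, Known.ν,
    Fin.sum_univ_two]
  ring

lemma sum_chr_one (D : F.NullData ε U S) (hy : y ∈ S) :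
    ∑ k, F.chr k k 1 (emb y) = 3 * F.known.ν y := by
  have hchr := fun k => D.regular.chr_symm (D.mem_nhds hy) k k 1
  simp only [sum_fin_four, hchr, D.chr_zero_one_zero hy, D.chr_one_one hy, D.chr_gk_one_gk hy,
    D.sum_nullShape hy]
  ring

lemma sum_chr_gk (D : F.NullData ε U S) (hy : y ∈ S) (c : Fin 2) :
    ∑ k, F.chr k k (gk c) (emb y) = F.known.logVolDeriv c y := by
  have hdom := D.subset_dom hy
  have hchr := D.regular.chr_symm (D.mem_nhds hy) 0 0 (gk c)
  have hq := D.metricOn.pd_q_symm hdom 0 c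
  simp only [sum_fin_four, hchr, D.chr_zero_gk_zero hy, hq, D.chr_one_one_gk hy, D.chr_gk_gk_gk hy,
    Known.logVolDeriv, Fin.sum_univ_two]
  simp only [D.metricOn.u_symm hdom 1 0, D.metricOn.pd_q_symm hdom _ 1 0]
  ring

lemma pd_zero_chr (D : F.NullData ε U S) (hy : y ∈ S) (a : Fin 2) :
    pd 0 (F.chr 0 1 (gk a)) (emb y) = F.known.n y * (pd (gs a) F.known.g122 y
      - 2 * F.known.g122 y * F.chr 1 1 (gk a) (emb y)
      - ∑ b, F.g2a1 b y * F.known.nullShape b a y) := by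
  have hU := D.mem_nhds hy
  have hg := D.regular.contDiffAt_g hU
  have hchr := D.regular.contDiffAt_chr hU
  have hg122 : ContDiffAt ℝ ∞ F.known.g122 y :=
    contDiffAt_pd (D.metricOn.contDiffAt_g12 (D.subset_dom hy))
  have hpd : pd 0 (pd (gk a) (F.g 1 1)) (emb y) = 2 * pd (gs a) F.known.g122 y := by
    rw [pd_comm 0 (gk a) (hg 1 1), D.pd_succ hy (fun z hz => D.pd_zero_g22 hz)
      (contDiffAt_pd (hg 1 1)) (contDiffAt_const.mul hg122)]
    simp (disch := fun_prop) only [pd_mul, pd_const, zero_mul, zero_add]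
  have hlow : Set.EqOn (fun x => ∑ k, F.g 1 k x * F.chr k 1 (gk a) x)
      (fun x => (1 / 2) * pd (gk a) (F.g 1 1) x) U := fun x hx => by
    simp only [D.regular.sum_g_mul_chr hx, low, add_sub_cancel_left]
  have hdiff := pd_congr_of_eqOn 0 hU hlow
  simp only [sum_fin_four, Fin.sum_univ_two] at hdiff
  simp (disch := fun_prop) only [pd_add, pd_mul, pd_const, hpd, D.g2a _ y hy, D.g22 y hy,
    D.chr_zero_one_gk hy, D.pd_zero_g22 hy, D.chr_gk_one_gk hy, D.symm hy 1 0] at hdiff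
  have hn : F.known.n y * F.g 0 1 (emb y) = 1 := D.metricOn.n_mul_g12 (D.subset_dom hy)
  simp only [g2a1, Fin.sum_univ_two]
  linear_combination F.known.n y * hdiff - pd 0 (F.chr 0 1 (gk a)) (emb y) * hn

lemma sum_pd_chr (D : F.NullData ε U S) (hy : y ∈ S) (a : Fin 2) :
    ∑ k, pd k (F.chr k 1 (gk a)) (emb y) = pd 0 (F.chr 0 1 (gk a)) (emb y)
      + pd 0 (fun z => F.chr 1 1 (gk a) (emb z)) y
      + ∑ b, pd (gs b) (F.known.nullShape b a) y := by
  have hchr := D.regular.contDiffAt_chr (D.mem_nhds hy)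
  have hshape := fun b => D.metricOn.contDiffAt_nullShape (D.subset_dom hy) b a
  have hone : pd 1 (F.chr 1 1 (gk a)) (emb y) = pd 0 (fun z => F.chr 1 1 (gk a) (emb z)) y :=
    (pd_comp_emb 0 (differentiableAt_of_contDiffAt (hchr 1 1 (gk a)))).symm
  have hgk : ∀ b, pd (gk b) (F.chr (gk b) 1 (gk a)) (emb y) = pd (gs b) (F.known.nullShape b a) y :=
    fun b => D.pd_succ hy (fun z hz => D.chr_gk_one_gk hz b a) (hchr _ _ _) (hshape b) (gs b)
  simp only [sum_fin_four, hone, hgk]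

lemma sum_pd_trace_chr (D : F.NullData ε U S) (hy : y ∈ S) (a : Fin 2) :
    ∑ k, pd (gk a) (F.chr k 1 k) (emb y) = 3 * pd (gs a) F.known.ν y := by
  have hchr := D.regular.contDiffAt_chr (D.mem_nhds hy)
  have hν := D.metricOn.contDiffAt_ν (D.subset_dom hy)
  have htrace : ∀ z ∈ S, ∑ k, F.chr k 1 k (emb z) = 3 * F.known.ν z := fun z hz => by
    simpa only [D.regular.chr_symm (D.mem_nhds hz) _ _ 1] using D.sum_chr_one hz
  rw [← pd_sum (gk a) fun k => differentiableAt_of_contDiffAt (hchr k 1 k),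
    D.pd_succ hy htrace (by fun_prop) (by fun_prop)]
  simp (disch := fun_prop) only [pd_mul, pd_const, zero_mul, zero_add]

lemma sum_chr_mul_chr (D : F.NullData ε U S) (hy : y ∈ S) (a : Fin 2) :
    ∑ k, ∑ l, (F.chr k k l (emb y) * F.chr l 1 (gk a) (emb y)
        - F.chr k (gk a) l (emb y) * F.chr l 1 k (emb y))
      = 3 * F.known.ν y * F.chr 1 1 (gk a) (emb y)
        + ∑ c, F.known.logVolDeriv c y * F.known.nullShape c a y
        - F.known.ν y * F.chr 0 (gk a) 0 (emb y)
        - ∑ c, F.chr 1 1 (gk c) (emb y) * F.known.nullShape c a y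
        + (1 / 2) * F.known.n y * ∑ c, pd 0 (F.known.q a c) y * F.chr (gk c) 1 0 (emb y)
        - ∑ d, ∑ c, F.known.nullShape d c y * F.chr (gk c) (gk a) (gk d) (emb y) := by
  have htrace : ∑ k, ∑ l, F.chr k k l (emb y) * F.chr l 1 (gk a) (emb y)
      = 3 * F.known.ν y * F.chr 1 1 (gk a) (emb y)
        + ∑ c, F.known.logVolDeriv c y * F.known.nullShape c a y := by
    rw [Finset.sum_comm]
    simp only [← Finset.sum_mul]
    simp only [sum_fin_four (fun l => (∑ k, F.chr k k l (emb y)) * _), D.sum_chr_one hy,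
      D.sum_chr_gk hy, D.chr_zero_one_gk hy, D.chr_gk_one_gk hy, mul_zero, zero_add]
  have hchr := D.regular.chr_symm (D.mem_nhds hy)
  simp only [Finset.sum_sub_distrib]
  rw [htrace]
  simp only [sum_fin_four, hchr _ (gk a) 1, D.chr_one_one hy,
    D.chr_zero_one_zero hy, D.chr_zero_one_gk hy, D.chr_gk_one_gk hy, D.chr_zero_gk_gk hy,
    Fin.sum_univ_two]
  ring

/-- Modulo known terms, `R_{2α}` transports `Γ²_{2α}`. -/
lemma ricci_eq (D : F.NullData ε U S) (hy : y ∈ S) (a : Fin 2) :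
    F.ricci 1 (gk a) (emb y) = pd 0 (fun z => F.chr 1 1 (gk a) (emb z)) y
      + 2 * F.known.ν y * F.chr 1 1 (gk a) (emb y)
      - F.known.n y * F.known.ν y * pd (gs a) F.known.g12 y
      + F.known.n y * pd (gs a) F.known.g122 y - 3 * pd (gs a) F.known.ν y
      + ∑ b, pd (gs b) (F.known.nullShape b a) y
      + (1 / 2) * ∑ l, F.known.nullShape l a y *
          ∑ m, ∑ t, F.known.u m t y * pd (gs l) (F.known.q m t) y
      + (1 / 4) * ∑ b, ∑ l, pd 0 (F.known.u b l) y * pd (gs a) (F.known.q l b) y := by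
  have hdom := D.subset_dom hy
  have hpu : ∀ b l, pd 0 (F.known.u b l) y
      = -2 * ∑ c, F.known.nullShape b c y * F.known.u c l y := fun b l => by
    simp only [D.metricOn.pd_u hdom, Known.nullShape, Fin.sum_univ_two,
      D.metricOn.pd_q_symm hdom 0 1 0]
    ring
  rw [ricci, Finset.sum_sub_distrib, D.sum_pd_chr hy, D.sum_pd_trace_chr hy, D.sum_chr_mul_chr hy,
    D.pd_zero_chr hy]
  simp only [D.chr_one_one_gk hy, D.chr_zero_gk_zero hy, D.chr_gk_one_zero hy, D.chr_gk_gk_gk hy,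
    hpu, Known.logVolDeriv]
  simp only [Known.nullShape, Known.ν, Fin.sum_univ_two]
  simp only [D.metricOn.u_symm hdom 1 0, D.metricOn.pd_q_symm hdom _ 1 0,
    fun i b => D.metricOn.pd_q_symm hdom i b a]
  ring

lemma combR_eq (D : F.NullData ε U S) (hy : y ∈ S) (a : Fin 2) :
    F.combR a (emb y) = F.known.rhsR F.unkG a y := by
  have hdom := D.subset_dom hy
  have hz := D.contDiffAt_unkG hy
  have hΓ := D.contDiffAt_loweredΓ hy a
  have hchr := D.contDiffAt_chr_comp_emb hy 1 1 (gk a)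
  have hs := D.metricOn.contDiffAt_s hdom a
  have hrate : ContDiffAt ℝ ∞ (F.known.shiftRate F.unkG a) y := by
    have hn := D.metricOn.contDiffAt_n hdom
    have hu := D.metricOn.contDiffAt_u hdom
    have hq := D.metricOn.contDiffAt_q hdom
    unfold Known.shiftRate
    fun_prop
  have hcancel := pd_eq_of_eqOn 0 (D.subset_closure_interior hy)
    (fun z hz => D.chr_add_half_loweredΓ hz a) (by fun_prop) (by fun_prop)
  have hsum : pd 0 (fun z => F.chr 1 1 (gk a) (emb z) + (1 / 2) * F.loweredΓ a z) y
      = pd 0 (fun z => F.chr 1 1 (gk a) (emb z)) y + pd 0 (fun z => (1 / 2) * F.loweredΓ a z) y :=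
    pd_add 0 (differentiableAt_of_contDiffAt hchr) (by fun_prop)
  rw [hsum] at hcancel
  simp (disch := fun_prop) only [pd_add, pd_mul, pd_const, zero_mul, zero_add] at hcancel
  rw [D.combR_eq_ricci_add hy, D.ricci_eq hy, D.metricOn.rhsR_eq hdom hz, D.metricOn.c_eq hdom]
  linear_combination hcancel + 2 * F.known.ν y * D.chr_add_half_loweredΓ hy a

end NullData

end Fields

/-! ### The Yang-Mills component -/

lemma sum_smul_eq_zero_of_symm_of_antisymm {ι R M : Type*} [Fintype ι] [Ring R] [AddCommGroup M]
    [Module R M] [IsAddTorsionFree M] {f : ι → ι → R} {v : ι → ι → M}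
    (hf : ∀ i j, f i j = f j i) (hv : ∀ i j, v i j = -v j i) :
    ∑ i, ∑ j, f i j • v i j = 0 := by
  rw [← self_eq_neg, ← Finset.sum_neg_distrib]
  conv_lhs => rw [Finset.sum_comm]
  refine Finset.sum_congr rfl fun i _ => ?_
  rw [← Finset.sum_neg_distrib]
  exact Finset.sum_congr rfl fun j _ => by rw [hf j i, hv j i, smul_neg]

namespace Fields

variable {𝔤 : Type*} [LieRing 𝔤] [LieAlgebra ℝ 𝔤] {N : ℕ} {F : Fields 𝔤}
  {ε : Module.Basis (Fin N) ℝ 𝔤}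

/-- The gauge quantity `g^{ij} A_{j,i} = Δ + Γ^l A_l`. -/
def coordDiv (F : Fields 𝔤) (ε : Module.Basis (Fin N) ℝ 𝔤) : Sp 4 → 𝔤 := fun x =>
  ∑ i, ∑ j, F.gInv i j x • pdL ε i (F.A j) x

lemma curv_antisymm (i j : Fin 4) (x : Sp 4) : F.curv ε i j x = -F.curv ε j i x := by
  rw [curv, curv, ← lie_skew (F.A j x) (F.A i x)]
  abel

lemma curv_self (i : Fin 4) (x : Sp 4) : F.curv ε i i x = 0 := by
  rw [curv, sub_self, lie_self, add_zero]

lemma curvUp_antisymm (i j : Fin 4) (x : Sp 4) : F.curvUp ε i j x = -F.curvUp ε j i x := by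
  simp only [curvUp, ← Finset.sum_neg_distrib]
  rw [Finset.sum_comm]
  refine Finset.sum_congr rfl fun a _ => Finset.sum_congr rfl fun b _ => ?_
  rw [curv_antisymm b a, smul_neg, mul_comm]

lemma curvUp_self (i : Fin 4) (x : Sp 4) : F.curvUp ε i i x = 0 :=
  have : IsAddTorsionFree 𝔤 := .of_isTorsionFree ℝ 𝔤
  self_eq_neg.1 (curvUp_antisymm i i x)

lemma Δ_eq (x : Sp 4) : F.Δ ε x = F.coordDiv ε x - ∑ l, F.Γ l x • F.A l x := by
  have htrace : ∑ l, F.Γ l x • F.A l x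
      = ∑ i, ∑ k, F.gInv i k x • ∑ l, F.chr l i k x • F.A l x := by
    simp only [Γ, Finset.sum_smul, Finset.smul_sum, smul_smul]
    rw [Finset.sum_comm]
    exact Finset.sum_congr rfl fun i _ => Finset.sum_comm
  simp only [htrace, Δ, coordDiv, smul_sub, Finset.sum_sub_distrib]

namespace RegularOn

variable {U : Set (Sp 4)} {x : Sp 4}

lemma smoothAt_curvUp (hF : F.RegularOn ε U) (hU : U ∈ 𝓝 x) (i j : Fin 4) :
    SmoothAt ε (F.curvUp ε i j) x := by
  have hgInv := hF.contDiffAt_gInv hU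
  have hA := hF.smoothAt_A hU
  unfold curvUp curv
  fun_prop

lemma smoothAt_coordDiv (hF : F.RegularOn ε U) (hU : U ∈ 𝓝 x) : SmoothAt ε (F.coordDiv ε) x := by
  have hgInv := hF.contDiffAt_gInv hU
  have hA := hF.smoothAt_A hU
  unfold coordDiv
  fun_prop

lemma pdL_Δ (hF : F.RegularOn ε U) (hU : U ∈ 𝓝 x) (p : Fin 4) :
    pdL ε p (F.Δ ε) x = pdL ε p (F.coordDiv ε) x
      - ∑ l, (pd p (F.Γ l) x • F.A l x + F.Γ l x • pdL ε p (F.A l) x) := by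
  have hd := hF.smoothAt_coordDiv hU
  have hΓ := hF.contDiffAt_Γ hU
  have hA := hF.smoothAt_A hU
  rw [funext Δ_eq]
  simp (disch := fun_prop) only [pdL_sub, pdL_sum, pdL_smul]

lemma divCurv_eq (hF : F.RegularOn ε U) (hU : U ∈ 𝓝 x) (j : Fin 4) :
    F.divCurv ε j x = ∑ i, (pdL ε i (F.curvUp ε i j) x + ⁅F.A i x, F.curvUp ε i j x⁆)
      + ∑ m, (∑ i, F.chr i i m x) • F.curvUp ε m j x := by
  have : IsAddTorsionFree 𝔤 := .of_isTorsionFree ℝ 𝔤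
  have hchr : ∑ i, ∑ m, F.chr j i m x • F.curvUp ε i m x = 0 :=
    sum_smul_eq_zero_of_symm_of_antisymm (hF.chr_symm hU j) (curvUp_antisymm · · x)
  simp only [divCurv, Finset.sum_add_distrib, hchr, Finset.sum_smul]
  rw [Finset.sum_comm (f := fun i m => F.chr i i m x • F.curvUp ε m j x)]
  abel

end RegularOn

namespace NullData

variable {U : Set (Sp 4)} {S : Set (Sp 3)} {y : Sp 3}

lemma smoothAt_known_A (D : F.NullData ε U S) (hy : y ∈ S) (a : Fin 2) :
    SmoothAt ε (F.known.A a) y :=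
  (D.regular.smoothAt_A (D.mem_nhds hy) (gk a)).comp_emb

lemma smoothAt_unkA (D : F.NullData ε U S) (hy : y ∈ S) : SmoothAt ε F.unkA y :=
  (D.regular.smoothAt_A (D.mem_nhds hy) 0).comp_emb

lemma pdL_succ_A (D : F.NullData ε U S) (hy : y ∈ S) (i : Fin 3) (j : Fin 4) :
    pdL ε i.succ (F.A j) (emb y) = pdL ε i (fun z => F.A j (emb z)) y :=
  (pdL_comp_emb i (D.regular.smoothAt_A (D.mem_nhds hy) j)).symm

lemma pdL_succ_A2 (D : F.NullData ε U S) (hy : y ∈ S) (i : Fin 3) :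
    pdL ε i.succ (F.A 1) (emb y) = 0 :=
  (D.pdL_succ hy D.A2 (D.regular.smoothAt_A (D.mem_nhds hy) 1) (fun I => by
    simpa only [map_zero] using contDiffAt_const) i).trans (pdL_zero i)

lemma curv_zero_one (D : F.NullData ε U S) (hy : y ∈ S) :
    F.curv ε 0 1 (emb y) = pdL ε 0 (F.A 1) (emb y) - pdL ε 0 F.unkA y := by
  rw [curv, D.A2 y hy, lie_zero, add_zero]
  exact congrArg _ (D.pdL_succ_A hy 0 0)

lemma curv_gk_one (D : F.NullData ε U S) (hy : y ∈ S) (a : Fin 2) :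
    F.curv ε (gk a) 1 (emb y) = -pdL ε 0 (F.known.A a) y := by
  rw [curv, D.A2 y hy, lie_zero, add_zero, D.pdL_succ_A2 hy (gs a), zero_sub]
  exact congrArg _ (D.pdL_succ_A hy 0 (gk a))

lemma curv_gk_gk (D : F.NullData ε U S) (hy : y ∈ S) (a b : Fin 2) :
    F.curv ε (gk a) (gk b) (emb y) = pdL ε (gs a) (F.known.A b) y
      - pdL ε (gs b) (F.known.A a) y + ⁅F.known.A a y, F.known.A b y⁆ := by
  rw [curv, D.pdL_succ_A hy (gs a), D.pdL_succ_A hy (gs b)]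
  rfl

lemma curvUp_zero (D : F.NullData ε U S) (hy : y ∈ S) (i : Fin 4) :
    F.curvUp ε i 0 (emb y) = F.known.n y • ∑ k, F.gInv i k (emb y) • F.curv ε k 1 (emb y) := by
  simp only [curvUp, sum_fin_four fun l => (_ * F.gInv 0 l (emb y)) • _, D.gInv_zero_zero hy,
    D.gInv_zero_one hy, D.gInv_zero_gk hy, mul_zero, zero_smul, zero_add, Finset.sum_const_zero,
    add_zero, Finset.smul_sum, smul_smul, mul_comm (F.known.n y)]

lemma curvUp_one_zero (D : F.NullData ε U S) (hy : y ∈ S) :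
    F.curvUp ε 1 0 (emb y) = F.known.n y • (F.known.n y • F.curv ε 0 1 (emb y)
      + ∑ l, F.unkG l y • F.known.w₂ ε l y) := by
  simp only [D.curvUp_zero hy, sum_fin_four, D.gInv_one_zero hy, D.gInv_one_gk hy, curv_self,
    D.curv_gk_one hy, Known.w₂, Fin.sum_univ_two, D.metricOn.u_symm (D.subset_dom hy) 1 0]
  module

lemma curvUp_gk_zero (D : F.NullData ε U S) (hy : y ∈ S) (a : Fin 2) :
    F.curvUp ε (gk a) 0 (emb y) = -F.known.w₂ ε a y := by
  simp only [D.curvUp_zero hy, sum_fin_four, D.gInv_gk_zero hy, D.gInv_gk_gk hy, curv_self,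
    D.curv_gk_one hy, Known.w₂, D.metricOn.u_symm (D.subset_dom hy) a, Fin.sum_univ_two]
  module

lemma coordDiv_eq (D : F.NullData ε U S) (hy : y ∈ S) :
    F.coordDiv ε (emb y) = F.known.n y • (pdL ε 0 (F.A 1) (emb y) + pdL ε 0 F.unkA y)
      - ∑ l, F.unkG l y • F.known.w₂ ε l y
      + ∑ a, ∑ b, F.known.u a b y • pdL ε (gs b) (F.known.A a) y := by
  have hA := D.pdL_succ_A hy 0 0
  have hA2 := D.pdL_succ_A2 hy 0
  have hAa := fun a => D.pdL_succ_A hy 0 (gk a)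
  change pdL ε 1 _ _ = pdL ε 0 F.unkA y at hA
  change pdL ε 1 _ _ = _ at hA2
  change ∀ a, pdL ε 1 _ _ = pdL ε 0 (F.known.A a) y at hAa
  have hAab : ∀ a b, pdL ε (gk b) (F.A (gk a)) (emb y) = pdL ε (gs b) (F.known.A a) y :=
    fun a b => D.pdL_succ_A hy (gs b) (gk a)
  simp only [coordDiv, sum_fin_four, D.gInv_zero_zero hy, D.gInv_zero_one hy, D.gInv_zero_gk hy,
    D.gInv_one_zero hy, D.gInv_gk_zero hy, D.gInv_gk_one hy, D.gInv_one_gk hy, D.gInv_gk_gk hy,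
    hA, hA2, hAa, hAab, D.pdL_succ_A2 hy (gs _), Known.w₂, Fin.sum_univ_two,
    D.metricOn.u_symm (D.subset_dom hy) 1 0]
  module

/-- The transversal derivative `A_{2,1}` cancels. -/
lemma g12_smul_curvUp_sub_coordDiv (D : F.NullData ε U S) (hy : y ∈ S) :
    F.known.g12 y • F.curvUp ε 1 0 (emb y) - F.coordDiv ε (emb y)
      = F.known.gaugeRate ε F.unkA F.unkG y := by
  have hn := D.metricOn.n_mul_g12 (D.subset_dom hy)
  rw [D.curvUp_one_zero hy, D.coordDiv_eq hy, D.curv_zero_one hy, Known.gaugeRate]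
  linear_combination (norm := (simp only [Fin.sum_univ_two]; module)) hn •
    (F.known.n y • (pdL ε 0 (F.A 1) (emb y) - pdL ε 0 F.unkA y)
      + ∑ l, F.unkG l y • F.known.w₂ ε l y)

lemma divCurv_zero (D : F.NullData ε U S) (hy : y ∈ S) :
    F.divCurv ε 0 (emb y) = pdL ε 0 (fun z => F.curvUp ε 1 0 (emb z)) y
      + (3 * F.known.ν y) • F.curvUp ε 1 0 (emb y)
      - ∑ l, (pdL ε (gs l) (F.known.w₂ ε l) y + F.known.logVolDeriv l y • F.known.w₂ ε l y)
      - F.known.n y • ∑ a, ∑ b, F.known.u a b y • ⁅F.known.A a y, pdL ε 0 (F.known.A b) y⁆ := by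
  have hU := D.mem_nhds hy
  have hdom := D.subset_dom hy
  have hF := D.regular.smoothAt_curvUp hU
  have hone : pdL ε 1 (F.curvUp ε 1 0) (emb y) = pdL ε 0 (fun z => F.curvUp ε 1 0 (emb z)) y :=
    (pdL_comp_emb 0 (hF 1 0)).symm
  have hneg : ∀ l z, -F.known.w₂ ε l z = (-1 : ℝ) • F.known.w₂ ε l z := fun l z =>
    (neg_one_smul ℝ _).symm
  have hw₂ := D.metricOn.smoothAt_w₂ hdom (D.smoothAt_known_A hy)
  have hgk : ∀ l, pdL ε (gk l) (F.curvUp ε (gk l) 0) (emb y) = -pdL ε (gs l) (F.known.w₂ ε l) y :=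
    fun l => by
      refine (D.pdL_succ hy (g := fun z => (-1 : ℝ) • F.known.w₂ ε l z)
        (fun z hz => (D.curvUp_gk_zero hz l).trans (hneg l z)) (hF (gk l) 0) (by fun_prop)
        (gs l)).trans ?_
      rw [pdL_smul (gs l) contDiffAt_const (hw₂ l), pd_const, zero_smul, zero_add, neg_one_smul]
  have hlie : ∀ a, ⁅F.A (gk a) (emb y), F.known.w₂ ε a y⁆
      = F.known.n y • ∑ b, F.known.u a b y • ⁅F.known.A a y, pdL ε 0 (F.known.A b) y⁆ := fun a => by
    rw [show F.A (gk a) (emb y) = F.known.A a y from rfl]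
    simp only [Known.w₂, lie_sum, lie_smul, Finset.smul_sum, smul_smul, D.metricOn.u_symm hdom a]
  rw [D.regular.divCurv_eq hU]
  simp only [sum_fin_four (M := 𝔤), D.sum_chr_one hy, D.sum_chr_gk hy, hone, hgk,
    funext (curvUp_self 0), pdL_zero, D.A2 y hy, zero_lie, lie_zero, D.curvUp_gk_zero hy, lie_neg,
    hlie, Fin.sum_univ_two]
  module

lemma combA_eq_divCurv_sub (D : F.NullData ε U S) (hy : y ∈ S) :
    F.combA ε (emb y) = F.known.g12 y • F.divCurv ε 0 (emb y)
      - pdL ε 0 (fun z => F.coordDiv ε (emb z)) y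
      - (2 * F.known.ν y) • F.coordDiv ε (emb y) := by
  have hU := D.mem_nhds hy
  have hg12 : pd 1 (F.g 0 1) (emb y) = F.known.g122 y := D.pd_succ_g hy 0 0 1
  have hdiv : pdL ε 1 (F.coordDiv ε) (emb y) = pdL ε 0 (fun z => F.coordDiv ε (emb z)) y :=
    (pdL_comp_emb 0 (D.regular.smoothAt_coordDiv hU)).symm
  have hA2 : pdL ε 1 (F.A 1) (emb y) = 0 := D.pdL_succ_A2 hy 0
  have hΓ : pd 1 (F.Γ 0) (emb y) = 0 :=
    (D.pd_succ hy (fun z hz => D.Γ_zero hz) (D.regular.contDiffAt_Γ hU 0) contDiffAt_const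
      0).trans (pd_const 0 0 y)
  have hg : F.g 0 1 (emb y) = F.known.g12 y := rfl
  have hga : ∀ a, F.g (gk a) 1 (emb y) = 0 := fun a => (D.symm hy (gk a) 1).trans (D.g2a a y hy)
  simp only [combA, LA, D.regular.pdL_Δ hU, Δ_eq, sum_fin_four, hdiv, hA2, hΓ, hg, hga, hg12,
    D.Γ_zero hy, D.A2 y hy, D.g22 y hy, D.gInv_zero_one hy, Known.ν, Fin.sum_univ_two]
  module

lemma combA_eq (D : F.NullData ε U S) (hy : y ∈ S) :
    F.combA ε (emb y) = F.known.rhsA ε F.unkA F.unkG y := by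
  have hdom := D.subset_dom hy
  have hA := D.smoothAt_known_A hy
  have hX := D.smoothAt_unkA hy
  have hz := D.contDiffAt_unkG hy
  have hg12 := D.metricOn.contDiffAt_g12 hdom
  have hF := (D.regular.smoothAt_curvUp (D.mem_nhds hy) 1 0).comp_emb
  have hd := (D.regular.smoothAt_coordDiv (D.mem_nhds hy)).comp_emb
  have hrate : SmoothAt ε (F.known.gaugeRate ε F.unkA F.unkG) y := by
    have hn := D.metricOn.contDiffAt_n hdom
    have hu := D.metricOn.contDiffAt_u hdom
    have hw₂ := D.metricOn.smoothAt_w₂ hdom hA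
    unfold Known.gaugeRate
    fun_prop
  have hcancel : F.known.g122 y • F.curvUp ε 1 0 (emb y)
      + F.known.g12 y • pdL ε 0 (fun z => F.curvUp ε 1 0 (emb z)) y
      - pdL ε 0 (fun z => F.coordDiv ε (emb z)) y
      = pdL ε 0 (F.known.gaugeRate ε F.unkA F.unkG) y := by
    rw [← pdL_eq_of_eqOn 0 (D.subset_closure_interior hy)
      (fun z hz => D.g12_smul_curvUp_sub_coordDiv hz) ((hF.smul hg12).sub hd) hrate,
      pdL_sub 0 (hF.smul hg12) hd, pdL_smul 0 hg12 hF]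
    rfl
  have hn := D.metricOn.n_mul_g12 hdom
  have hν := D.metricOn.g12_mul_ν hdom
  rw [D.combA_eq_divCurv_sub hy, D.divCurv_zero hy, D.metricOn.rhsA_eq hdom hA hX hz]
  linear_combination (norm := module) hcancel
    + (2 * F.known.ν y) • D.g12_smul_curvUp_sub_coordDiv hy
    + hν • F.curvUp ε 1 0 (emb y)
    - hn • ∑ a, ∑ b, F.known.u a b y • ⁅F.known.A a y, pdL ε 0 (F.known.A b) y⁆

end NullData

end Fields

/-! ### The linear system -/

namespace Known

variable {𝔤 : Type*} {K : Known 𝔤} {y : Sp 3}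

lemma sum_κ_mul (v : Fin 2 → ℝ) (a : Fin 2) :
    ∑ l, K.κ a l y * v l = K.n y ^ 2 * K.g122 y * v a
      - ∑ b, ∑ l, pd 0 (K.q a b) y * K.u b l y * K.n y * v l := by
  simp only [κ, sub_mul, Finset.sum_sub_distrib, ite_mul, zero_mul, Finset.sum_ite_eq,
    Finset.mem_univ, if_true, Finset.sum_mul]
  rw [Finset.sum_comm]
  simp only [mul_comm, mul_left_comm]

variable [LieRing 𝔤] [LieAlgebra ℝ 𝔤] {N : ℕ} {ε : Module.Basis (Fin N) ℝ 𝔤}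

lemma linearODE_lhs_eq {B : LinearMap.BilinForm ℝ 𝔤} (hB : B.IsSymm) (X : Sp 3 → 𝔤)
    (z : Fin 2 → Sp 3 → ℝ) (a : Fin 2) :
    K.n y * pd 0 (pd 0 (z a)) y + ∑ l, K.κ a l y * pd 0 (z l) y + B (K.ϰ ε a y) (pdL ε 0 X y)
        + ∑ l, K.χ ε B a l y * z l y + K.dig ε B a y
      = K.rhsR z a y - B (pdL ε 0 (K.A a) y) (K.gaugeRate ε X z y)
        - ∑ b, ∑ l, K.u b l y * B (pdL ε 0 (K.A b) y) (pdL ε (gs a) (K.A l) y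
            - pdL ε (gs l) (K.A a) y + ⁅K.A a y, K.A l y⁆)
        - B (pdL ε 0 K.Φ y) (pdL ε (gs a) K.Φ y + ⁅K.A a y, K.Φ y⁆) := by
  have hcurv : ∀ b l, B (pdL ε (gs l) (K.A a) y - pdL ε (gs a) (K.A l) y + ⁅K.A l y, K.A a y⁆)
      (pdL ε 0 (K.A b) y) = -B (pdL ε 0 (K.A b) y) (pdL ε (gs a) (K.A l) y
        - pdL ε (gs l) (K.A a) y + ⁅K.A a y, K.A l y⁆) := fun b l => by
    rw [← map_neg, ← lie_skew (K.A l y), ← hB.eq]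
    congr 1
    abel
  rw [sum_κ_mul]
  simp only [rhsR, χ, dig, hcurv]
  simp only [ϰ, gaugeRate, w₂, Fin.sum_univ_two, map_add, map_sub, map_smul, LinearMap.smul_apply,
    smul_eq_mul]
  ring

end Known

namespace Fields.NullData

variable {𝔤 : Type*} [LieRing 𝔤] [LieAlgebra ℝ 𝔤] {N : ℕ} {F : Fields 𝔤}
  {ε : Module.Basis (Fin N) ℝ 𝔤} {U : Set (Sp 4)} {S : Set (Sp 3)} {y : Sp 3}

lemma dHiggs_one (D : F.NullData ε U S) (hy : y ∈ S) :
    F.dHiggs ε 1 (emb y) = pdL ε 0 F.known.Φ y := by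
  rw [dHiggs, D.A2 y hy, zero_lie, add_zero]
  exact (pdL_comp_emb 0 (D.regular.smoothAt_Φ (D.mem_nhds hy))).symm

lemma dHiggs_gk (D : F.NullData ε U S) (hy : y ∈ S) (a : Fin 2) :
    F.dHiggs ε (gk a) (emb y) = pdL ε (gs a) F.known.Φ y + ⁅F.known.A a y, F.known.Φ y⁆ := by
  rw [dHiggs, ← pdL_comp_emb (gs a) (D.regular.smoothAt_Φ (D.mem_nhds hy))]
  rfl

lemma J_one (D : F.NullData ε U S) (hy : y ∈ S) : F.J ε 1 (emb y) = F.known.j2 ε y := by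
  have hg : F.g 1 0 (emb y) = F.known.g12 y := D.symm hy 1 0
  simp only [J, currentUp, sum_fin_four, D.g22 y hy, D.g2a _ y hy, hg, D.dHiggs_one hy,
    D.gInv_zero_zero hy, D.gInv_zero_one hy, D.gInv_zero_gk hy, Finset.sum_const_zero,
    zero_smul, zero_add, add_zero, lie_smul, smul_smul, mul_comm (F.known.g12 y),
    D.metricOn.n_mul_g12 (D.subset_dom hy), one_smul]
  rfl

lemma τ_one_gk (D : F.NullData ε U S) {B : LinearMap.BilinForm ℝ 𝔤} (hB : B.IsSymm) (V : ℝ → ℝ)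
    (hy : y ∈ S) (a : Fin 2) :
    F.τ ε B V 1 (gk a) (emb y)
      = B (pdL ε 0 (F.known.A a) y) (F.known.g12 y • F.curvUp ε 1 0 (emb y))
        + ∑ b, ∑ l, F.known.u b l y * B (pdL ε 0 (F.known.A b) y) (pdL ε (gs a) (F.known.A l) y
            - pdL ε (gs l) (F.known.A a) y + ⁅F.known.A a y, F.known.A l y⁆)
        + B (pdL ε 0 F.known.Φ y)
            (pdL ε (gs a) F.known.Φ y + ⁅F.known.A a y, F.known.Φ y⁆) := by
  have hn := D.metricOn.n_mul_g12 (D.subset_dom hy)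
  have hcurvUp : F.known.g12 y • F.curvUp ε 1 0 (emb y)
      = F.known.n y • F.curv ε 0 1 (emb y) + ∑ l, F.unkG l y • F.known.w₂ ε l y := by
    rw [D.curvUp_one_zero hy, smul_smul, mul_comm, hn, one_smul]
  have hcurv10 : F.curv ε 1 0 (emb y) = -F.curv ε 0 1 (emb y) := curv_antisymm 1 0 _
  have hcurv1 : ∀ b, F.curv ε 1 (gk b) (emb y) = pdL ε 0 (F.known.A b) y := fun b => by
    rw [curv_antisymm, D.curv_gk_one hy, neg_neg]
  have hcomm : ∀ v, B v (pdL ε 0 (F.known.A a) y) = B (pdL ε 0 (F.known.A a) y) v :=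
    fun v => hB.eq _ _
  rw [hcurvUp, τ, D.g2a a y hy, D.dHiggs_one hy, D.dHiggs_gk hy]
  simp only [sum_fin_four, hcurv10, hcurv1, curv_self, D.curv_gk_one hy, D.curv_gk_gk hy,
    D.gInv_zero_zero hy, D.gInv_zero_one hy, D.gInv_zero_gk hy, D.gInv_gk_zero hy,
    D.gInv_gk_one hy, D.gInv_gk_gk hy, Known.w₂, Fin.sum_univ_two, map_add, map_neg, map_smul,
    map_zero, LinearMap.zero_apply, LinearMap.neg_apply, smul_eq_mul, hcomm]
  ring

lemma Δ_add_sum_Γ_smul_A (D : F.NullData ε U S) (hy : y ∈ S) :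
    F.Δ ε (emb y) + ∑ b, F.Γ (gk b) (emb y) • F.A (gk b) (emb y) = F.coordDiv ε (emb y) := by
  rw [Δ_eq, sum_fin_four, D.Γ_zero hy, D.A2 y hy, zero_smul, smul_zero, zero_add, zero_add,
    sub_add_cancel]

lemma combR_add_sub_τ (D : F.NullData ε U S) {B : LinearMap.BilinForm ℝ 𝔤} (hB : B.IsSymm)
    (V : ℝ → ℝ) (hy : y ∈ S) (a : Fin 2) :
    F.combR a (emb y)
        + ∑ b, B (F.A (gk b) (emb y)) (pdL ε 1 (F.A (gk a)) (emb y)) * F.Γ (gk b) (emb y)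
        + B (pdL ε 1 (F.A (gk a)) (emb y)) (F.Δ ε (emb y)) - F.τ ε B V 1 (gk a) (emb y)
      = F.known.rhsR F.unkG a y
        - B (pdL ε 0 (F.known.A a) y) (F.known.gaugeRate ε F.unkA F.unkG y)
        - ∑ b, ∑ l, F.known.u b l y * B (pdL ε 0 (F.known.A b) y) (pdL ε (gs a) (F.known.A l) y
            - pdL ε (gs l) (F.known.A a) y + ⁅F.known.A a y, F.known.A l y⁆)
        - B (pdL ε 0 F.known.Φ y)
            (pdL ε (gs a) F.known.Φ y + ⁅F.known.A a y, F.known.Φ y⁆) := by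
  have hA : pdL ε 1 (F.A (gk a)) (emb y) = pdL ε 0 (F.known.A a) y := D.pdL_succ_A hy 0 (gk a)
  have hcomm : ∀ v, B v (pdL ε 0 (F.known.A a) y) = B (pdL ε 0 (F.known.A a) y) v :=
    fun v => hB.eq _ _
  have hΔ := congrArg (B (pdL ε 0 (F.known.A a) y)) (D.Δ_add_sum_Γ_smul_A hy)
  simp only [map_add, map_sum, map_smul, smul_eq_mul, mul_comm (F.Γ _ _)] at hΔ
  rw [D.combR_eq hy, D.τ_one_gk hB V hy, ← D.g12_smul_curvUp_sub_coordDiv hy, hA, map_sub]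
  simp only [hcomm]
  linear_combination hΔ

lemma modifiedReduced_iff (D : F.NullData ε U S) {B : LinearMap.BilinForm ℝ 𝔤} (hB : B.IsSymm)
    (V : ℝ → ℝ) (hy : y ∈ S) :
    F.ModifiedReduced ε B V (emb y) ↔ F.known.LinearODE ε B F.unkA F.unkG y := by
  refine and_congr (forall_congr' fun a => ?_) ?_
  · rw [← sub_eq_zero, D.combR_add_sub_τ hB V hy, ← Known.linearODE_lhs_eq hB]
  · rw [← sub_eq_zero, D.combA_eq hy, D.J_one hy]
    simp only [Known.rhsA, Known.bA, smul_smul, mul_comm (2 : ℝ) (pd 0 _ _), add_sub_assoc]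

end Fields.NullData

namespace Fields.Stage

variable {𝔤 : Type*} [LieRing 𝔤] {F : Fields 𝔤} {S : Set (Sp 3)} {Ω : Sp 3 → ℝ}
  {h : Fin 2 → Fin 2 → Sp 3 → ℝ} {y : Sp 3}

lemma det_q (hS : F.Stage S Ω h) (hy : y ∈ S) :
    (Matrix.of fun a b => F.known.q a b y).det = Ω y ^ 2 := by
  have hq : (Matrix.of fun a b => F.known.q a b y) = Ω y • Matrix.of fun a b => h a b y :=
    Matrix.ext fun a b => hS.conf a b y hy
  rw [hq, Matrix.det_smul, hS.det_h y hy, mul_one, Fintype.card_fin]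

/-- Take the logarithmic derivative of `det (g_{αβ}) = Ω²`. -/
lemma tr2_eq (hS : F.Stage S Ω h) (hy : y ∈ S) (hcl : y ∈ closure (interior S))
    (hq : ∀ a b, ContDiffAt ℝ ∞ (F.known.q a b) y) (hΩ : ContDiffAt ℝ ∞ Ω y) :
    F.known.tr2 y = 2 * (pd 0 Ω y / Ω y) := by
  have hΩ0 := (hS.Ω_pos y hy).ne'
  have hdet0 : (Matrix.of fun a b => F.known.q a b y).det ≠ 0 := by
    rw [hS.det_q hy]
    exact pow_ne_zero 2 hΩ0
  have hpd := pd_eq_of_eqOn 0 hcl (fun z hz => (hS.det_q hz).trans (sq (Ω z)))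
    (contDiffAt_det hq) (hΩ.mul hΩ)
  rw [pd_det_fin_two 0 hq hdet0, hS.det_q hy, pd_mul 0 (differentiableAt_of_contDiffAt hΩ)
    (differentiableAt_of_contDiffAt hΩ)] at hpd
  change Ω y ^ 2 * F.known.tr2 y = _ at hpd
  field_simp
  exact mul_left_cancel₀ hΩ0 (by linear_combination hpd)

lemma nullData [LieAlgebra ℝ 𝔤] {N : ℕ} {ε : Module.Basis (Fin N) ℝ 𝔤} {U : Set (Sp 4)}
    (hS : F.Stage S Ω h) (hF : F.RegularOn ε U) (hU : IsOpen U)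
    (hSU : ∀ y ∈ S, emb y ∈ U) (hcl : S ⊆ closure (interior S))
    (hΩ : ContDiffOn ℝ ∞ Ω (emb ⁻¹' U)) : F.NullData ε U S where
  isOpen := hU
  regular := hF
  emb_mem := hSU
  subset_closure_interior := hcl
  g22 := hS.g22
  g2a := hS.g2a
  A2 := hS.A2
  g122 y hy := by
    have hq : ∀ a b, ContDiffAt ℝ ∞ (F.known.q a b) y := fun a b =>
      contDiffAt_comp_emb (hF.contDiffAt_g (hU.mem_nhds (hSU y hy)) (gk a) (gk b))
    have hΩy := hΩ.contDiffAt ((hU.preimage contDiff_emb.continuous).mem_nhds (hSU y hy))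
    rw [hS.g12 y hy, hS.tr2_eq hy (hcl hy) hq hΩy]
    ring
  g221 := hS.g221

end Fields.Stage

end EYMH

end

theorem proposition3p7_general {𝔤 : Type*} [LieRing 𝔤] [LieAlgebra ℝ 𝔤] {N : ℕ}
    {ε : Module.Basis (Fin N) ℝ 𝔤} {B : LinearMap.BilinForm ℝ 𝔤} (hB : B.IsSymm) (V : ℝ → ℝ)
    {U : Set (EYMH.Sp 4)} {S : Set (EYMH.Sp 3)} {F : EYMH.Fields 𝔤} (D : F.NullData ε U S) :
    (∀ y ∈ S, (∀ a : Fin 2, F.combR a (EYMH.emb y) = F.known.rhsR F.unkG a y) ∧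
      F.combA ε (EYMH.emb y) = F.known.rhsA ε F.unkA F.unkG y) ∧
    (∀ y ∈ S, F.ModifiedReduced ε B V (EYMH.emb y) ↔ F.known.LinearODE ε B F.unkA F.unkG y) :=
  ⟨fun _ hy => ⟨D.combR_eq hy, D.combA_eq hy⟩, fun _ hy => D.modifiedReduced_iff hB V hy⟩

theorem proposition3p7 {𝔤 : Type*} [LieRing 𝔤] [LieAlgebra ℝ 𝔤] {N : ℕ}
    (ε : Module.Basis (Fin N) ℝ 𝔤)
    (B : LinearMap.BilinForm ℝ 𝔤) (hB_symm : B.IsSymm) (hB_nondeg : B.Nondegenerate)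
    (hB_inv : ∀ f k l : 𝔤, B f ⁅k, l⁆ = B ⁅f, k⁆ l)
    (V : ℝ → ℝ) (hV : ContDiff ℝ ∞ V)
    (L : Set (EYMH.Sp 4)) (T₁ : ℝ)
    (hG : EYMH.slice L T₁ ⊆ closure (interior (EYMH.slice L T₁)))
    (U : Set (EYMH.Sp 4)) (hU : IsOpen U) (hGU : EYMH.G1 L T₁ ⊆ U)
    (F : EYMH.Fields 𝔤) (hF : F.RegularOn ε U)
    (Ω : EYMH.Sp 3 → ℝ) (h : Fin 2 → Fin 2 → EYMH.Sp 3 → ℝ)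
    (hΩ : ContDiffOn ℝ ∞ Ω (EYMH.emb ⁻¹' U))
    (hS : F.Stage (EYMH.slice L T₁) Ω h) :
    (∀ y ∈ EYMH.slice L T₁,
      (∀ a : Fin 2, F.combR a (EYMH.emb y) = F.known.rhsR F.unkG a y) ∧
      F.combA ε (EYMH.emb y) = F.known.rhsA ε F.unkA F.unkG y) ∧
    (∀ y ∈ EYMH.slice L T₁,
      F.ModifiedReduced ε B V (EYMH.emb y) ↔ F.known.LinearODE ε B F.unkA F.unkG y) :=
  proposition3p7_general hB_symm V (hS.nullData hF hU (fun _ hy => hGU hy) hG hΩ)
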